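/- Let $n\ge 2$ and $d\ge 1$ be integers. Let $\mathcal H_d^{\mathbb R}$ be the space of real homogeneous polynomials of degree $d$ in $X_1,\dots,X_n$ with the Bombieri–Weyl inner product, for which the polynomials $\sqrt{\tfrac{d!}{\alpha_1!\cdots\alpha_n!}}\,X^\alpha$, $|\alpha|=d$, form an orthonormal basis, and give $(\mathcal H_d^{\mathbb R})^n$ the inner product $\langle f,g\rangle=\sum_{i=1}^n\langle f_i,g_i\rangle$. Let $$\varphi(f)=(2\pi)^{-\frac12\dim (\mathcal H_d^{\mathbb R})^n}\,e^{-\|f\|^2/2}$$ be the standard normal density on $(\mathcal H_d^{\mathbb R})^n$. For $f\in(\mathcal H_d^{\mathbb R})^n$ let $F_f:\mathbb R^n\times\mathbb R\to\mathbb R^n$, $F_f(x,t)=f(x)-t\,x$. Let $$\mathbf V=\{(f,v,\lambda)\in(\mathcal H_d^{\mathbb R})^n\times \mathbb S(\mathbb R^n)\times\mathbb R \;:\; f(v)=\lambda v\},$$ where $\mathbb S(\mathbb R^n)$ is the unit sphere, and let $\pi_2:\mathbf V\to\mathbb S(\mathbb R^n)\times\mathbb R$ be the projection $(f,v,\lambda)\mapsto(v,\lambda)$.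 For $v\in \mathbb S(\mathbb R^n)$ put $T_v=\{y\in\mathbb R^n:\langle v,y\rangle=0\}$ and $$J(v,\lambda)=\int_{(f,v,\lambda)\in\pi_2^{-1}(v,\lambda)}\bigl|\det DF_f(v,\lambda)|_{T_v\times\mathbb R}\bigr|\;\varphi(f)\;\mathrm d\pi_2^{-1}(v,\lambda),$$ where the integral is with respect to the Riemannian volume of the fiber and the absolute determinant of the linear map $T_v\times\mathbb R\to\mathbb R^n$ is taken with respect to orthonormal bases. For $a>0$ and $x\ge0$ let $\Gamma(a,x)=\int_x^\infty t^{a-1}e^{-t}\,\mathrm dt$ and $\gamma(a,x)=\int_0^x t^{a-1}e^{-t}\,\mathrm dt$. Let $e_1=(1,0,\dots,0)\in\mathbb R^n$. Then for every $\lambda\in\mathbb R$ the integral $J(e_1,\lambda)$ converges and $$J(e_1,\lambda)=\frac{\sqrt d^{\,n-1}\,\Gamma(\frac n2)}{\sqrt\pi^{\,n}}\left(e^{\lambda^2/(2d)}\,\frac{\Gamma\bigl(n-1,\frac{\lambda^2}{d}\bigr)}{\Gamma(n-1)}+2^{n-2}\Bigl(\frac{\lambda^2}{2d}\Bigr)^{\frac{n-1}{2}}\frac{\gamma\bigl(\frac{n-1}{2},\frac{\lambda^2}{2d}\bigr)}{\Gamma(n-1)}\right)\frac{1}{\sqrt{2\pi}}\,e^{-\lambda^2/2}.$$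 -/

import Mathlib

open MeasureTheory

noncomputable section

namespace TensorEig

/-- The real vector space `H_d` of real homogeneous polynomials of degree `d` in the `n` variables
`X_0, …, X_{n-1}` (a copy of Mathlib's submodule, so that it can carry the Bombieri-Weyl norm). -/
def HomPoly (n d : ℕ) : Type :=
  MvPolynomial.homogeneousSubmodule (Fin n) ℝ d

instance (n d : ℕ) : AddCommGroup (HomPoly n d) :=
  inferInstanceAs (AddCommGroup (MvPolynomial.homogeneousSubmodule (Fin n) ℝ d))

instance (n d : ℕ) : Module ℝ (HomPoly n d) :=
  inferInstanceAs (Module ℝ (MvPolynomial.homogeneousSubmodule (Fin n) ℝ d))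

/-- The underlying polynomial, as a linear map. -/
def HomPoly.toPoly (n d : ℕ) : HomPoly n d →ₗ[ℝ] MvPolynomial (Fin n) ℝ :=
  (MvPolynomial.homogeneousSubmodule (Fin n) ℝ d).subtype

/-- The (finite) set of exponents `α ∈ ℕⁿ` with `|α| = d`. -/
def exponents (n d : ℕ) : Finset (Fin n →₀ ℕ) :=
  (Finset.univ : Finset (Fin n)).finsuppAntidiag d

/-- The coordinate `a_α` of `f = ∑ a_α e_α` in the Bombieri-Weyl basis
`e_α = √(d! / (α_1! ⋯ α_n!)) X^α`. -/
def HomPoly.bwCoord {n d : ℕ} (f : HomPoly n d) (α : Fin n →₀ ℕ) : ℝ :=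
  MvPolynomial.coeff α (HomPoly.toPoly n d f) / √(α.multinomial : ℝ)

/-- The coordinates determine the polynomial: `f = ∑_{|α| = d} a_α √(d! / α!) X^α`. -/
theorem HomPoly.eq_sum_bwCoord {n d : ℕ} (f : HomPoly n d) :
    HomPoly.toPoly n d f =
      ∑ α ∈ exponents n d, MvPolynomial.monomial α (f.bwCoord α * √(α.multinomial : ℝ)) := by
  have hf : (HomPoly.toPoly n d f).IsHomogeneous d := f.2
  ext β
  have hm : √(β.multinomial : ℝ) ≠ 0 := by
    have : 0 < β.multinomial := Nat.multinomial_pos _ _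
    positivity
  rw [MvPolynomial.coeff_sum]
  simp only [MvPolynomial.coeff_monomial, Finset.sum_ite_eq']
  split_ifs with h
  · simp only [bwCoord]
    field_simp
  · by_contra hne
    apply h
    have hdeg : β.degree = d := by
      rw [Finsupp.degree_eq_weight_one]
      exact hf hne
    simp only [exponents, Finset.mem_finsuppAntidiag, Finset.subset_univ, and_true]
    rw [← hdeg, Finsupp.degree_eq_sum]

/-- The Bombieri-Weyl inner product `⟨∑ a_α e_α, ∑ b_α e_α⟩ = ∑ a_α b_α` on `H_d`. -/
@[reducible] def HomPoly.bombieriWeylCore (n d : ℕ) : InnerProductSpace.Core ℝ (HomPoly n d) where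
  inner f g := ∑ α ∈ exponents n d, f.bwCoord α * g.bwCoord α
  conj_inner_symm f g := by simp [mul_comm]
  re_inner_nonneg f := by
    simpa using Finset.sum_nonneg fun α _ => mul_self_nonneg (f.bwCoord α)
  add_left f g h := by
    simp [bwCoord, add_div, add_mul, Finset.sum_add_distrib]
  smul_left f g r := by
    simp [bwCoord, Finset.mul_sum, mul_div_assoc, mul_assoc]
  definite f hf := by
    have h0 := (Finset.sum_eq_zero_iff_of_nonneg
      fun α _ => mul_self_nonneg (f.bwCoord α)).1 hf
    have : HomPoly.toPoly n d f = 0 := by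
      rw [f.eq_sum_bwCoord]
      refine Finset.sum_eq_zero fun α hα => ?_
      rw [mul_self_eq_zero.1 (h0 α hα), zero_mul, map_zero]
    exact Subtype.ext this

instance (n d : ℕ) : NormedAddCommGroup (HomPoly n d) :=
  (HomPoly.bombieriWeylCore n d).toNormedAddCommGroup

instance (n d : ℕ) : InnerProductSpace ℝ (HomPoly n d) :=
  InnerProductSpace.ofCore (HomPoly.bombieriWeylCore n d).toCore

instance (n d : ℕ) : FiniteDimensional ℝ (HomPoly n d) :=
  Module.Finite.iff_fg.2 (MvPolynomial.homogeneousSubmodule_fg (Fin n) ℝ d)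

instance (n d : ℕ) : MeasurableSpace (HomPoly n d) := borel _

instance (n d : ℕ) : BorelSpace (HomPoly n d) := ⟨rfl⟩

/-- The space `(H_d)^n` of systems `f = (f_1, …, f_n)`, with `⟨f, g⟩ = ∑ i, ⟨f_i, g_i⟩`. -/
abbrev PolySystem (n d : ℕ) : Type := PiLp 2 fun _ : Fin n => HomPoly n d

/-- `ℝⁿ` with its standard inner product. -/
abbrev E (n : ℕ) : Type := EuclideanSpace ℝ (Fin n)

/-- The value `f(x) ∈ ℝⁿ` of a system at a point. -/
def PolySystem.evalAt {n d : ℕ} (f : PolySystem n d) (x : E n) : E n :=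
  WithLp.toLp 2 fun i => MvPolynomial.eval (fun j => x j) (HomPoly.toPoly n d (f i))

/-- The map `F_f : ℝⁿ × ℝ → ℝⁿ`, `F_f(x, t) = f(x) - t x`. -/
def eigenMap {n d : ℕ} (f : PolySystem n d) (p : E n × ℝ) : E n :=
  f.evalAt p.1 - p.2 • p.1

/-- The real solution manifold `V = {(f, v, λ) ∈ (H_d)^n × S(ℝⁿ) × ℝ | f(v) = λ v}`. -/
def solutionManifold (n d : ℕ) : Set (PolySystem n d × Metric.sphere (0 : E n) 1 × ℝ) :=
  {p | p.1.evalAt p.2.1 = p.2.2 • (p.2.1 : E n)}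

/-- The fiber over `(v, lam)` of the projection `V → S(ℝⁿ) × ℝ`, identified through the isometry
`(f, v, lam) ↦ f` with a subset of `(H_d)^n`. It is an affine subspace of codimension `n`. -/
def fiber {n d : ℕ} (v : Metric.sphere (0 : E n) 1) (lam : ℝ) : Set (PolySystem n d) :=
  {f | (f, v, lam) ∈ solutionManifold n d}

/-- The Riemannian volume measure of the fiber over `(v, lam)`, as a measure on `(H_d)^n`
supported on the fiber: the Hausdorff measure in the dimension `dim (H_d)^n - n` of the fiber,
normalized to agree with Lebesgue measure on Euclidean spaces of that dimension. -/
def fiberMeasure {n d : ℕ} (v : Metric.sphere (0 : E n) 1) (lam : ℝ) :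
    Measure (PolySystem n d) :=
  (Measure.euclideanHausdorffMeasure (Module.finrank ℝ (PolySystem n d) - n)).restrict
    (fiber v lam)

/-- The tangent space `T_v = {y ∈ ℝⁿ | ⟨v, y⟩ = 0}`. -/
abbrev tangentSpace {n : ℕ} (v : E n) : Submodule ℝ (E n) := (ℝ ∙ v)ᗮ

/-- The restriction of the derivative `DF_f(v, lam)` to `T_v × ℝ ⊆ ℝⁿ × ℝ`, where `T_v × ℝ`
carries the Euclidean product inner product. -/
def restrictedDeriv {n d : ℕ} (f : PolySystem n d) (v : E n) (lam : ℝ) :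
    WithLp 2 (tangentSpace v × ℝ) →ₗ[ℝ] E n :=
  (fderiv ℝ (eigenMap f) (v, lam)).toLinearMap ∘ₗ
    ((tangentSpace v).subtype.prodMap LinearMap.id) ∘ₗ
    (WithLp.linearEquiv 2 ℝ (tangentSpace v × ℝ)).toLinearMap

/-- The absolute value `|det L|` of the determinant of a linear map between Euclidean spaces of
the same dimension with respect to orthonormal bases, computed as `√(det (Lᵀ L))`. -/
def absDet {U W : Type*} [NormedAddCommGroup U] [InnerProductSpace ℝ U] [FiniteDimensional ℝ U]
    [NormedAddCommGroup W] [InnerProductSpace ℝ W] [FiniteDimensional ℝ W]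
    (L : U →ₗ[ℝ] W) : ℝ :=
  √(LinearMap.det (L.adjoint ∘ₗ L))

/-- `absDet` is the absolute determinant of the matrix of the map in orthonormal bases. -/
theorem absDet_eq_abs_det_toMatrix {U W ι : Type*} [Fintype ι] [DecidableEq ι]
    [NormedAddCommGroup U] [InnerProductSpace ℝ U] [FiniteDimensional ℝ U]
    [NormedAddCommGroup W] [InnerProductSpace ℝ W] [FiniteDimensional ℝ W]
    (b : OrthonormalBasis ι ℝ U) (c : OrthonormalBasis ι ℝ W) (L : U →ₗ[ℝ] W) :
    absDet L = |(LinearMap.toMatrix b.toBasis c.toBasis L).det| := by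
  rw [absDet, ← LinearMap.det_toMatrix b.toBasis,
    LinearMap.toMatrix_comp b.toBasis c.toBasis b.toBasis,
    LinearMap.toMatrix_adjoint, Matrix.det_mul, Matrix.det_conjTranspose]
  simp [Real.sqrt_mul_self_eq_abs]

/-- The standard normal density `φ_E(z) = (2π)^{-dim E / 2} exp(-‖z‖² / 2)`. -/
def stdNormalDensity (U : Type*) [NormedAddCommGroup U] [InnerProductSpace ℝ U] (z : U) : ℝ :=
  (√(2 * Real.pi) ^ Module.finrank ℝ U)⁻¹ * Real.exp (-‖z‖ ^ 2 / 2)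

/-- The integrand `|det DF_f(v, lam)|_{T_v × ℝ}| φ(f)`. -/
def fiberIntegrand {n d : ℕ} (v : Metric.sphere (0 : E n) 1) (lam : ℝ) (f : PolySystem n d) : ℝ :=
  absDet (restrictedDeriv f v lam) * stdNormalDensity (PolySystem n d) f

/-- The fiber integral `J(v, lam) = ∫_{fiber over (v, lam)} |det DF_f(v, lam)|_{T_v × ℝ}| φ(f)`. -/
def J {n : ℕ} (d : ℕ) (v : Metric.sphere (0 : E n) 1) (lam : ℝ) : ℝ :=
  ∫ f : PolySystem n d, fiberIntegrand v lam f ∂(fiberMeasure v lam)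

/-- The first standard basis vector `e_1 = (1, 0, …, 0)`, a point of the unit sphere. -/
def e1 (n : ℕ) [NeZero n] : Metric.sphere (0 : E n) 1 :=
  ⟨EuclideanSpace.single 0 1, by simp⟩

/-- The upper incomplete Gamma function `Γ(a, x) = ∫_x^∞ t^{a-1} e^{-t} dt`. -/
def upperGamma (a x : ℝ) : ℝ := ∫ t in Set.Ioi x, t ^ (a - 1) * Real.exp (-t)

/-- The lower incomplete Gamma function `γ(a, x) = ∫_0^x t^{a-1} e^{-t} dt`. -/
def lowerGamma (a x : ℝ) : ℝ := ∫ t in Set.Ioc 0 x, t ^ (a - 1) * Real.exp (-t)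

end TensorEig

end

/-! The integral reduces to the mean absolute determinant of a shifted Gaussian matrix. At e_1 the
fiber condition fixes only the coefficients of X_0^d. The fiber is therefore an isometric copy of a
Euclidean space (`fiberMeasure_eq_map`), on which the density splits off the normal density of λ
(`stdNormalDensity_fiberParam`). The restricted derivative sees only the coefficients of the
monomials X_0^(d-1) X_j. Its absolute determinant is √d^(n-1) |det(G - μI)| with μ = λ/√d, where G
is a standard Gaussian matrix of size n-1 (`absDet_restrictedDeriv`, `map_linearEntries`).

To average |det M| for M = G - μI of size m, write (2π)^(m/2) |det M| as the integral over v of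
det(M)² exp(-‖Mv‖²/2) (`integral_detKernel`). This replaces the absolute value by a polynomial with
a Gaussian weight. After Fubini, invariance under orthogonal conjugation turns v into a multiple of
a basis vector. Expanding det² over pairs of permutations then leaves only the equal pairs
(`integral_det_sq_mul_exp_column`), and counting fixed points produces truncated exponential series.
The remaining radial integral becomes elementary with w = r/√(1+r²) (`integral_radialMoment`): its
boundary term is an upper incomplete Gamma value and the rest a lower one. Legendre duplication
collects the constants (`gaussian_constant`). -/

namespace TensorEig

/-! ### Permutations weighted by their fixed points -/

section PermSums

variable {ι : Type*} [Fintype ι] [DecidableEq ι]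

theorem card_perm_fixing (T : Finset ι) :
    (Finset.univ.filter fun σ : Equiv.Perm ι => ∀ i ∈ T, σ i = i).card =
      (Fintype.card ι - T.card).factorial := by
  have e := Equiv.Perm.subtypeEquivSubtypePerm (fun i : ι => i ∉ T)
  rw [← Fintype.card_coe T, ← Fintype.card_subtype_compl, ← Fintype.card_perm,
    Fintype.card_congr e, Fintype.card_subtype]
  congr 1
  ext σ
  simp

/-- Expand the product over subsets U of S. Each U contributes x^|U| times the number of
permutations fixing T ∪ U, which depends only on |U|. -/
theorem sum_perm_fixing_prod_one_add (x : ℝ) (S T : Finset ι) (h : Disjoint S T) :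
    ∑ σ : Equiv.Perm ι, (if ∀ i ∈ T, σ i = i then
        ∏ i ∈ S, (1 + if σ i = i then x else 0) else 0) =
      ∑ j ∈ Finset.range (S.card + 1),
        (S.card.choose j : ℝ) * ((Fintype.card ι - T.card - j).factorial * x ^ j) := by
  have h1 : ∀ σ : Equiv.Perm ι, (if ∀ i ∈ T, σ i = i then
        ∏ i ∈ S, (1 + if σ i = i then x else 0) else 0) =
      ∑ U ∈ S.powerset, if ∀ i ∈ T ∪ U, σ i = i then x ^ U.card else 0 := by
    intro σ
    rw [Finset.prod_one_add]
    split_ifs with hT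
    · refine Finset.sum_congr rfl fun U _ => ?_
      rw [Finset.prod_ite_zero, Finset.prod_const]
      congr 1
      simp only [Finset.mem_union, or_imp, forall_and, eq_iff_iff]
      tauto
    · refine (Finset.sum_eq_zero fun U _ => if_neg fun hU => hT fun i hi => ?_).symm
      exact hU i (Finset.mem_union_left _ hi)
  simp_rw [h1]
  rw [Finset.sum_comm]
  have h2 : ∀ U ∈ S.powerset,
      (∑ σ : Equiv.Perm ι, if ∀ i ∈ T ∪ U, σ i = i then x ^ U.card else 0) =
        ((Fintype.card ι - T.card - U.card).factorial : ℝ) * x ^ U.card := by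
    intro U hU
    rw [← Finset.sum_filter, Finset.sum_const, card_perm_fixing, Finset.card_union_of_disjoint
      (h.mono_left (Finset.mem_powerset.1 hU)).symm, nsmul_eq_mul, Nat.sub_add_eq]
  rw [Finset.sum_congr rfl h2, Finset.sum_powerset_apply_card
    (fun j => ((Fintype.card ι - T.card - j).factorial : ℝ) * x ^ j)]
  simp

/-- The scaled exponential polynomial `m! ∑_{j ≤ m} x^j / j!`. -/
noncomputable def expPoly (m : ℕ) (x : ℝ) : ℝ :=
  ∑ j ∈ Finset.range (m + 1), (m.choose j : ℝ) * ((m - j).factorial * x ^ j)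

theorem expPoly_eq (m : ℕ) (x : ℝ) :
    expPoly m x = m.factorial * ∑ j ∈ Finset.range (m + 1), x ^ j / j.factorial := by
  rw [expPoly, Finset.mul_sum]
  refine Finset.sum_congr rfl fun j hj => ?_
  rw [← Nat.choose_mul_factorial_mul_factorial (Nat.lt_succ_iff.1 (Finset.mem_range.1 hj))]
  have : (j.factorial : ℝ) ≠ 0 := by positivity
  push_cast
  field_simp

theorem expPoly_succ (m : ℕ) (x : ℝ) :
    expPoly (m + 1) x = (m + 1) * expPoly m x + x ^ (m + 1) := by
  rw [expPoly_eq, expPoly_eq, Finset.sum_range_succ, Nat.factorial_succ]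
  have : ((m + 1).factorial : ℝ) ≠ 0 := by positivity
  rw [Nat.factorial_succ] at this
  push_cast at this ⊢
  field_simp

theorem sum_perm_prod_one_add (x : ℝ) :
    ∑ σ : Equiv.Perm ι, ∏ i, (1 + if σ i = i then x else 0) = expPoly (Fintype.card ι) x := by
  simpa [expPoly] using
    sum_perm_fixing_prod_one_add x (Finset.univ : Finset ι) ∅ (Finset.disjoint_empty_right _)

/-- Changing the factor at i₀ from 1 + x to 1 + sx matters only for permutations fixing i₀, so the
correction is the restricted sum with T = {i₀}. -/
theorem sum_perm_prod_one_add_update (x s : ℝ) (i₀ : ι) :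
    ∑ σ : Equiv.Perm ι, ∏ i, (1 + (if i = i₀ then s else 1) * if σ i = i then x else 0) =
      expPoly (Fintype.card ι) x - x * (1 - s) * expPoly (Fintype.card ι - 1) x := by
  have h := sum_perm_fixing_prod_one_add x (Finset.univ.erase i₀) {i₀} (by simp)
  simp only [Finset.mem_singleton, forall_eq, Finset.card_erase_of_mem (Finset.mem_univ i₀),
    Finset.card_univ, Finset.card_singleton] at h
  rw [expPoly, expPoly, ← h, ← expPoly, ← sum_perm_prod_one_add, Finset.mul_sum,
    ← Finset.sum_sub_distrib]
  refine Finset.sum_congr rfl fun σ _ => ?_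
  rw [← Finset.mul_prod_erase _ _ (Finset.mem_univ i₀),
    ← Finset.mul_prod_erase (a := i₀) _ (fun i => 1 + if σ i = i then x else 0) (Finset.mem_univ i₀)]
  rw [Finset.prod_congr rfl (g := fun i => 1 + if σ i = i then x else 0) fun i hi => by
    rw [if_neg (Finset.ne_of_mem_erase hi), one_mul]]
  simp only [if_true]
  split_ifs <;> ring

end PermSums

/-! ### One-dimensional Gaussian integrals with a quadratic exponential weight -/

section WeightedGaussian

open ProbabilityTheory

/-- Completing the square: density times weight is a multiple of the normal density with variance
1/(1+c) and mean ac/(1+c). -/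
theorem integral_mul_exp_gaussianReal {c : ℝ} (hc : 0 ≤ c) (a : ℝ) (f : ℝ → ℝ) :
    ∫ t, f t * Real.exp (-(c * (t - a) ^ 2) / 2) ∂gaussianReal 0 1 =
      √(1 + c)⁻¹ * Real.exp (-(a ^ 2 * (1 - (1 + c)⁻¹)) / 2) *
        ∫ t, f t ∂gaussianReal (a * (1 - (1 + c)⁻¹)) (1 + c)⁻¹.toNNReal := by
  have hc' : 0 < 1 + c := by linarith
  have hs : 0 < (1 + c)⁻¹ := inv_pos.2 hc'
  rw [integral_gaussianReal_eq_integral_smul one_ne_zero,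
    integral_gaussianReal_eq_integral_smul (by simpa using hc'), ← integral_const_mul]
  refine integral_congr_ae (.of_forall fun t => ?_)
  simp only [gaussianPDFReal, smul_eq_mul, Real.coe_toNNReal _ hs.le, NNReal.coe_one, mul_one,
    sub_zero]
  have h1 : √(2 * Real.pi * (1 + c)⁻¹) = √(2 * Real.pi) * √(1 + c)⁻¹ :=
    Real.sqrt_mul (by positivity) _
  have h2 : Real.exp (-t ^ 2 / 2) * Real.exp (-(c * (t - a) ^ 2) / 2) =
      Real.exp (-(a ^ 2 * (1 - (1 + c)⁻¹)) / 2) *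
        Real.exp (-(t - a * (1 - (1 + c)⁻¹)) ^ 2 / (2 * (1 + c)⁻¹)) := by
    rw [← Real.exp_add, ← Real.exp_add]
    congr 1
    field_simp
    ring
  have h3 : √(1 + c)⁻¹ ≠ 0 := (Real.sqrt_pos.2 hs).ne'
  have h4 : √(2 * Real.pi) ≠ 0 := by positivity
  rw [h1]
  calc _ = (√(2 * Real.pi))⁻¹ * f t *
        (Real.exp (-t ^ 2 / 2) * Real.exp (-(c * (t - a) ^ 2) / 2)) := by ring
    _ = _ := by
      rw [h2]
      field_simp

theorem integral_sub_sq_gaussianReal (m a : ℝ) (v : NNReal) :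
    ∫ t, (t - a) ^ 2 ∂gaussianReal m v = v + (m - a) ^ 2 := by
  have h1 : Integrable (fun t : ℝ => (t - m) ^ 2) (gaussianReal m v) :=
    ((memLp_id_gaussianReal 2).sub (memLp_const m)).integrable_sq
  have h2 : Integrable (fun t : ℝ => t) (gaussianReal m v) :=
    (memLp_id_gaussianReal 1).integrable (by norm_num)
  have h3 : ∫ t, (t - m) ^ 2 ∂gaussianReal m v = v := by
    rw [← variance_fun_id_gaussianReal (μ := m) (v := v), variance_eq_integral (by fun_prop)]
    simp
  have h4 : ∀ t : ℝ, (t - a) ^ 2 = (t - m) ^ 2 + (2 * (m - a) * t + (m - a) * (-m - a)) :=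
    fun t => by ring
  have h5 : Integrable (fun t : ℝ => 2 * (m - a) * t + (m - a) * (-m - a)) (gaussianReal m v) :=
    (h2.const_mul _).add (integrable_const _)
  simp_rw [h4]
  rw [integral_add h1 h5, h3,
    integral_add (h2.const_mul _) (integrable_const _), integral_const_mul, integral_id_gaussianReal]
  simp

/-- The Gaussian mass of the weight `exp (-c (t - a)² / 2)`. -/
noncomputable def weightMass (c a : ℝ) : ℝ :=
  √(1 + c)⁻¹ * Real.exp (-(a ^ 2 * (1 - (1 + c)⁻¹)) / 2)

theorem integral_weight {c : ℝ} (hc : 0 ≤ c) (a : ℝ) :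
    ∫ t, Real.exp (-(c * (t - a) ^ 2) / 2) ∂gaussianReal 0 1 = weightMass c a := by
  simpa [weightMass] using integral_mul_exp_gaussianReal hc a 1

theorem integral_mul_weight {c : ℝ} (hc : 0 ≤ c) :
    ∫ t, t * Real.exp (-(c * t ^ 2) / 2) ∂gaussianReal 0 1 = 0 := by
  simpa using integral_mul_exp_gaussianReal hc 0 id

theorem integral_sq_mul_weight {c : ℝ} (hc : 0 ≤ c) (a : ℝ) :
    ∫ t, (t - a) ^ 2 * Real.exp (-(c * (t - a) ^ 2) / 2) ∂gaussianReal 0 1 =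
      weightMass c a * ((1 + c)⁻¹ * (1 + (1 + c)⁻¹ * a ^ 2)) := by
  rw [integral_mul_exp_gaussianReal hc a (fun t => (t - a) ^ 2), integral_sub_sq_gaussianReal,
    weightMass, Real.coe_toNNReal _ (by positivity)]
  ring

theorem integrable_pow_mul_weight {c : ℝ} (hc : 0 ≤ c) (a : ℝ) (k : ℕ) :
    Integrable (fun t => (t - a) ^ k * Real.exp (-(c * (t - a) ^ 2) / 2)) (gaussianReal 0 1) := by
  have h : Integrable (fun t : ℝ => (t - a) ^ k) (gaussianReal 0 1) :=
    (((memLp_id_gaussianReal k).sub (memLp_const a)).integrable_norm_pow'.mono'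
      (by fun_prop) (.of_forall fun t => by simp))
  refine h.mul_bdd (c := 1) (by fun_prop) (.of_forall fun t => ?_)
  rw [Real.norm_eq_abs, Real.abs_exp, Real.exp_le_one_iff]
  have : 0 ≤ c * (t - a) ^ 2 := by positivity
  linarith

end WeightedGaussian

/-! ### Column-weighted second moment of the determinant -/

section GaussianMatrix

open ProbabilityTheory

variable {ι : Type*} [Fintype ι] [DecidableEq ι]

/-- The law of the entries of a matrix with independent standard normal entries. -/
noncomputable def entryLaw (ι : Type*) [Fintype ι] : Measure (ι × ι → ℝ) :=
  Measure.pi fun _ => gaussianReal 0 1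

instance : IsProbabilityMeasure (entryLaw ι) := by
  unfold entryLaw; infer_instance

/-- The matrix `g - μ I`. -/
def shiftedMatrix (μ : ℝ) (g : ι × ι → ℝ) : Matrix ι ι ℝ :=
  Matrix.of fun i j => g (i, j) - if i = j then μ else 0

/-- The weight `exp (-½ ∑ⱼ cⱼ ∑ᵢ Mᵢⱼ²)` on the columns of a matrix. -/
noncomputable def columnWeight (c : ι → ℝ) (M : Matrix ι ι ℝ) : ℝ :=
  ∏ j, ∏ i, Real.exp (-(c j * M i j ^ 2) / 2)

/-- The contribution of a single entry `t = M i j` to the term of the pair `(σ, τ)` in the expansion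
of `det M ^ 2 * columnWeight c M`. -/
noncomputable def entryFactor (c : ι → ℝ) (σ τ : Equiv.Perm ι) (p : ι × ι) (a t : ℝ) : ℝ :=
  (t - a) ^ ((if σ p.2 = p.1 then 1 else 0) + if τ p.2 = p.1 then 1 else 0) *
    Real.exp (-(c p.2 * (t - a) ^ 2) / 2)

theorem det_sq_mul_columnWeight (c : ι → ℝ) (μ : ℝ) (g : ι × ι → ℝ) :
    (shiftedMatrix μ g).det ^ 2 * columnWeight c (shiftedMatrix μ g) =
      ∑ σ : Equiv.Perm ι, ∑ τ : Equiv.Perm ι,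
        ((Equiv.Perm.sign σ : ℤ) : ℝ) * ((Equiv.Perm.sign τ : ℤ) : ℝ) *
          ∏ p, entryFactor c σ τ p (if p.1 = p.2 then μ else 0) (g p) := by
  rw [sq, Matrix.det_apply', Finset.sum_mul_sum, Finset.sum_mul]
  refine Finset.sum_congr rfl fun σ _ => ?_
  rw [Finset.sum_mul]
  refine Finset.sum_congr rfl fun τ _ => ?_
  have h : ∏ p, entryFactor c σ τ p (if p.1 = p.2 then μ else 0) (g p) =
      (∏ j, shiftedMatrix μ g (σ j) j) * (∏ j, shiftedMatrix μ g (τ j) j) *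
        columnWeight c (shiftedMatrix μ g) := by
    rw [Fintype.prod_prod_type_right, columnWeight, ← Finset.prod_mul_distrib,
      ← Finset.prod_mul_distrib]
    refine Finset.prod_congr rfl fun j _ => ?_
    simp only [entryFactor, pow_add, Finset.prod_mul_distrib]
    simp [shiftedMatrix, pow_ite]
  rw [h]
  ring

omit [Fintype ι] in
theorem integrable_entryFactor {c : ι → ℝ} (hc : ∀ j, 0 ≤ c j) (σ τ : Equiv.Perm ι)
    (p : ι × ι) (a : ℝ) : Integrable (entryFactor c σ τ p a) (gaussianReal 0 1) :=
  integrable_pow_mul_weight (hc _) _ _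

/-- In a column j where σ and τ differ, the entries in rows σ j and τ j both occur to the first
power, and at least one of them is off the diagonal. That entry is centered, so its weighted first
moment vanishes. -/
theorem prod_integral_entryFactor_of_ne {c : ι → ℝ} (hc : ∀ j, 0 ≤ c j) {σ τ : Equiv.Perm ι}
    (h : σ ≠ τ) (μ : ℝ) :
    ∏ p : ι × ι, ∫ t, entryFactor c σ τ p (if p.1 = p.2 then μ else 0) t ∂gaussianReal 0 1 = 0 := by
  obtain ⟨j, hj⟩ : ∃ j, σ j ≠ τ j := by
    by_contra! h'
    exact h (Equiv.ext h')
  have key : ∀ i, i ≠ j → (if σ j = i then 1 else 0) + (if τ j = i then 1 else 0) = 1 →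
      ∫ t, entryFactor c σ τ (i, j) (if i = j then μ else 0) t ∂gaussianReal 0 1 = 0 := by
    intro i hij hd
    simpa [entryFactor, hd, hij] using integral_mul_weight (hc j)
  by_cases hσ : σ j = j
  · refine Finset.prod_eq_zero (Finset.mem_univ (τ j, j)) (key _ (fun h' => ?_) ?_)
    · exact hj (hσ.trans h'.symm)
    · simp [hj]
  · exact Finset.prod_eq_zero (Finset.mem_univ (σ j, j)) (key _ hσ (by simp [hj.symm]))

/-- Every entry of column j contributes its weighted mass, which involves μ only on the diagonal.
The entry in row σ j contributes a further second-moment factor, which involves μ only when j is a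
fixed point. -/
theorem prod_integral_entryFactor_self {c : ι → ℝ} (hc : ∀ j, 0 ≤ c j) (σ : Equiv.Perm ι) (μ : ℝ) :
    ∏ p : ι × ι, ∫ t, entryFactor c σ σ p (if p.1 = p.2 then μ else 0) t ∂gaussianReal 0 1 =
      (∏ j, (√(1 + c j)⁻¹ ^ Fintype.card ι * Real.exp (-(μ ^ 2 * (1 - (1 + c j)⁻¹)) / 2) *
          (1 + c j)⁻¹)) *
        ∏ j, (1 + (1 + c j)⁻¹ * if σ j = j then μ ^ 2 else 0) := by
  rw [Fintype.prod_prod_type_right, ← Finset.prod_mul_distrib]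
  refine Finset.prod_congr rfl fun j _ => ?_
  have h1 : ∀ i, ∫ t, entryFactor c σ σ (i, j) (if i = j then μ else 0) t ∂gaussianReal 0 1 =
      weightMass (c j) (if i = j then μ else 0) *
        if σ j = i then (1 + c j)⁻¹ * (1 + (1 + c j)⁻¹ * if σ j = j then μ ^ 2 else 0) else 1 := by
    intro i
    by_cases hi : σ j = i
    · subst hi
      simpa [entryFactor, ite_pow] using integral_sq_mul_weight (hc j) (if σ j = j then μ else 0)
    · simpa [entryFactor, hi] using integral_weight (hc j) (if i = j then μ else 0)
  have h2 : ∏ i, weightMass (c j) (if i = j then μ else 0) =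
      √(1 + c j)⁻¹ ^ Fintype.card ι * Real.exp (-(μ ^ 2 * (1 - (1 + c j)⁻¹)) / 2) := by
    simp only [weightMass, Finset.prod_mul_distrib, Finset.prod_const, Finset.card_univ]
    rw [Finset.prod_eq_single j (fun i _ hi => by simp [hi]) (by simp)]
    simp
  simp only [h1, Finset.prod_mul_distrib, h2, Finset.prod_ite_eq, Finset.mem_univ, if_true]
  ring

theorem integrable_det_sq_mul_columnWeight {c : ι → ℝ} (hc : ∀ j, 0 ≤ c j) (μ : ℝ) :
    Integrable (fun g => (shiftedMatrix μ g).det ^ 2 * columnWeight c (shiftedMatrix μ g))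
      (entryLaw ι) := by
  simp_rw [det_sq_mul_columnWeight]
  exact integrable_finsetSum _ fun σ _ => integrable_finsetSum _ fun τ _ =>
    (Integrable.fintype_prod fun p => integrable_entryFactor hc σ τ p _).const_mul _

theorem integral_det_sq_mul_columnWeight {c : ι → ℝ} (hc : ∀ j, 0 ≤ c j) (μ : ℝ) :
    ∫ g, (shiftedMatrix μ g).det ^ 2 * columnWeight c (shiftedMatrix μ g) ∂entryLaw ι =
      (∏ j, (√(1 + c j)⁻¹ ^ Fintype.card ι * Real.exp (-(μ ^ 2 * (1 - (1 + c j)⁻¹)) / 2) *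
          (1 + c j)⁻¹)) *
        ∑ σ : Equiv.Perm ι, ∏ j, (1 + (1 + c j)⁻¹ * if σ j = j then μ ^ 2 else 0) := by
  have hI : ∀ σ τ : Equiv.Perm ι, Integrable (fun g : ι × ι → ℝ =>
      ((Equiv.Perm.sign σ : ℤ) : ℝ) * ((Equiv.Perm.sign τ : ℤ) : ℝ) *
        ∏ p, entryFactor c σ τ p (if p.1 = p.2 then μ else 0) (g p)) (entryLaw ι) :=
    fun σ τ => (Integrable.fintype_prod fun p => integrable_entryFactor hc σ τ p _).const_mul _
  simp_rw [det_sq_mul_columnWeight]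
  rw [integral_finsetSum _ fun σ _ => integrable_finsetSum _ fun τ _ => hI σ τ, Finset.mul_sum]
  refine Finset.sum_congr rfl fun σ _ => ?_
  rw [integral_finsetSum _ fun τ _ => hI σ τ]
  simp_rw [integral_const_mul, entryLaw]
  simp_rw [integral_fintype_prod_eq_prod
    (f := fun p : ι × ι => entryFactor c σ _ p (if p.1 = p.2 then μ else 0))]
  rw [Finset.sum_eq_single σ (fun τ _ hτ => by
    rw [prod_integral_entryFactor_of_ne hc hτ.symm, mul_zero]) (by simp),
    prod_integral_entryFactor_self hc]
  rw [← Int.cast_mul, Int.units_coe_mul_self, Int.cast_one, one_mul]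

/-- The weighted second moment of `det (g - μ I)` with weight `exp (-½ r² ‖M e_{i₀}‖²)`. -/
noncomputable def radialMoment (m : ℕ) (x r : ℝ) : ℝ :=
  √(1 + r ^ 2)⁻¹ ^ m * Real.exp (-(x * (1 - (1 + r ^ 2)⁻¹)) / 2) * (1 + r ^ 2)⁻¹ *
    (expPoly m x - x * (1 - (1 + r ^ 2)⁻¹) * expPoly (m - 1) x)

theorem integral_det_sq_mul_exp_column (i₀ : ι) (r μ : ℝ) :
    ∫ g, (shiftedMatrix μ g).det ^ 2 *
        Real.exp (-(r ^ 2 * ∑ i, shiftedMatrix μ g i i₀ ^ 2) / 2) ∂entryLaw ι =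
      radialMoment (Fintype.card ι) (μ ^ 2) r := by
  have hw : ∀ M : Matrix ι ι ℝ, Real.exp (-(r ^ 2 * ∑ i, M i i₀ ^ 2) / 2) =
      columnWeight (fun j => if j = i₀ then r ^ 2 else 0) M := by
    intro M
    rw [columnWeight, Finset.prod_eq_single i₀ (fun j _ hj => by simp [hj]) (by simp),
      ← Real.exp_sum]
    simp [Finset.mul_sum, Finset.sum_div, neg_div]
  simp_rw [hw]
  rw [integral_det_sq_mul_columnWeight (fun j => by split_ifs <;> positivity), radialMoment,
    Finset.prod_eq_single i₀ (fun j _ hj => by simp [hj]) (by simp)]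
  have h := sum_perm_prod_one_add_update (μ ^ 2) (1 + r ^ 2)⁻¹ i₀
  rw [← h]
  simp only [if_true]
  congr 1
  refine Finset.sum_congr rfl fun σ _ => Finset.prod_congr rfl fun j _ => ?_
  by_cases hj : j = i₀ <;> simp [hj]

end GaussianMatrix

/-! ### Orthogonal invariance of the Gaussian matrix -/

section Rotation

open ProbabilityTheory WithLp

theorem map_pi_gaussianReal_of_sum_sq {κ : Type*} [Fintype κ] (L : (κ → ℝ) →ₗ[ℝ] (κ → ℝ))
    (hL : ∀ g, ∑ k, L g k ^ 2 = ∑ k, g k ^ 2) :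
    (Measure.pi fun _ : κ => gaussianReal 0 1).map L = Measure.pi fun _ => gaussianReal 0 1 := by
  let T : EuclideanSpace ℝ κ →ₗᵢ[ℝ] EuclideanSpace ℝ κ :=
    { toLinearMap := (WithLp.linearEquiv 2 ℝ (κ → ℝ)).symm.toLinearMap ∘ₗ L ∘ₗ
        (WithLp.linearEquiv 2 ℝ (κ → ℝ)).toLinearMap
      norm_map' := fun v => by
        rw [EuclideanSpace.norm_eq, EuclideanSpace.norm_eq]
        simpa using congrArg Real.sqrt (hL v.ofLp) }
  have h := stdGaussian_map (T.toLinearIsometryEquiv rfl)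
  rw [← map_pi_eq_stdGaussian, Measure.map_map (by fun_prop) (by fun_prop)] at h
  have hL' : Measurable L := L.continuous_of_finiteDimensional.measurable
  have h' := congrArg (Measure.map (ofLp : EuclideanSpace ℝ κ → κ → ℝ)) h
  rw [Measure.map_map (by fun_prop) (by fun_prop), Measure.map_map (by fun_prop) (by fun_prop)] at h'
  simpa [Function.comp_def, T] using h'

variable {ι : Type*} [Fintype ι] [DecidableEq ι]

open Matrix

theorem sum_sq_mulVec {R : Matrix ι ι ℝ} (hR : Rᵀ * R = 1) (v : ι → ℝ) :
    ∑ i, (R *ᵥ v) i ^ 2 = ∑ i, v i ^ 2 := by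
  have h : (R *ᵥ v) ⬝ᵥ (R *ᵥ v) = v ⬝ᵥ v := by
    rw [Matrix.dotProduct_mulVec, Matrix.vecMul_mulVec, hR, Matrix.vecMul_one]
  simpa [dotProduct, sq] using h

omit [DecidableEq ι] in
theorem sum_sq_eq_trace (A : Matrix ι ι ℝ) : ∑ p : ι × ι, A p.1 p.2 ^ 2 = (Aᵀ * A).trace := by
  rw [Fintype.sum_prod_type_right]
  simp [Matrix.trace, Matrix.mul_apply, sq]

/-- Conjugation `g ↦ R g Rᵀ` on the entries of a matrix. -/
def conjEntries (R : Matrix ι ι ℝ) : (ι × ι → ℝ) →ₗ[ℝ] (ι × ι → ℝ) where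
  toFun g p := (R * Matrix.of (fun i j => g (i, j)) * Rᵀ) p.1 p.2
  map_add' g h := by
    ext p
    rw [Pi.add_apply, ← Matrix.add_apply, ← Matrix.add_mul, ← Matrix.mul_add]
    rfl
  map_smul' a g := by
    ext p
    rw [RingHom.id_apply, Pi.smul_apply, ← Matrix.smul_apply, ← Matrix.smul_mul, ← Matrix.mul_smul]
    rfl

/-- Conjugation preserves tr(AᵀA), the squared norm of the entries, and a linear isometry preserves
the standard Gaussian law. -/
theorem map_conjEntries {R : Matrix ι ι ℝ} (hR : Rᵀ * R = 1) :
    (entryLaw ι).map (conjEntries R) = entryLaw ι := by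
  refine map_pi_gaussianReal_of_sum_sq _ fun g => ?_
  refine (sum_sq_eq_trace (R * Matrix.of (fun i j => g (i, j)) * Rᵀ)).trans
    (Eq.trans ?_ (sum_sq_eq_trace (Matrix.of fun i j => g (i, j))).symm)
  set A : Matrix ι ι ℝ := Matrix.of fun i j => g (i, j)
  calc _ = (R * (Aᵀ * (Rᵀ * R) * A * Rᵀ)).trace := by
        simp only [Matrix.transpose_mul, Matrix.transpose_transpose, Matrix.mul_assoc]
    _ = (Aᵀ * A * (Rᵀ * R)).trace := by
        rw [hR, Matrix.mul_one, Matrix.trace_mul_comm, Matrix.mul_assoc, hR]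
    _ = _ := by rw [hR, Matrix.mul_one]

omit [Fintype ι] in
theorem shiftedMatrix_eq (μ : ℝ) (g : ι × ι → ℝ) :
    shiftedMatrix μ g = Matrix.of (fun i j => g (i, j)) - μ • (1 : Matrix ι ι ℝ) := by
  ext i j
  simp [shiftedMatrix, Matrix.one_apply]

/-- Conjugation, unlike a one-sided rotation, fixes the shift μI. -/
theorem shiftedMatrix_conjEntries {R : Matrix ι ι ℝ} (hR : Rᵀ * R = 1) (μ : ℝ)
    (g : ι × ι → ℝ) : shiftedMatrix μ (conjEntries R g) = R * shiftedMatrix μ g * Rᵀ := by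
  rw [shiftedMatrix_eq, shiftedMatrix_eq, Matrix.mul_sub, Matrix.sub_mul, Matrix.mul_smul,
    Matrix.smul_mul, Matrix.mul_one, mul_eq_one_comm.1 hR]
  rfl

/-- The Householder reflection along u = v - w exchanges two vectors of equal length. -/
theorem exists_orthogonal_mulVec_eq {v w : ι → ℝ} (h : v ⬝ᵥ v = w ⬝ᵥ w) :
    ∃ R : Matrix ι ι ℝ, Rᵀ * R = 1 ∧ R *ᵥ v = w := by
  by_cases hvw : v = w
  · exact ⟨1, by simp, by simp [hvw]⟩
  set u := v - w with hu
  have hu0 : u ⬝ᵥ u ≠ 0 := by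
    rw [Ne, dotProduct_self_eq_zero]
    exact sub_ne_zero.2 hvw
  have huv : 2 * (u ⬝ᵥ v) = u ⬝ᵥ u := by
    simp only [hu, sub_dotProduct, dotProduct_sub, dotProduct_comm w v]
    linarith
  refine ⟨1 - (2 / (u ⬝ᵥ u)) • vecMulVec u u, ?_, ?_⟩
  · have ht : (1 - (2 / (u ⬝ᵥ u)) • vecMulVec u u)ᵀ = 1 - (2 / (u ⬝ᵥ u)) • vecMulVec u u := by
      rw [transpose_sub, transpose_smul, transpose_vecMulVec, transpose_one]
    have hW : vecMulVec u u * vecMulVec u u = (u ⬝ᵥ u) • vecMulVec u u := by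
      rw [vecMulVec_mul_vecMulVec, vecMulVec_smul]
    rw [ht, Matrix.sub_mul, Matrix.one_mul, Matrix.mul_sub, Matrix.mul_one, Matrix.smul_mul,
      Matrix.mul_smul, hW, smul_smul (_ / _) (u ⬝ᵥ u), div_mul_cancel₀ _ hu0]
    module
  · rw [Matrix.sub_mulVec, Matrix.one_mulVec, Matrix.smul_mulVec, vecMulVec_mulVec]
    ext i
    simp only [Pi.sub_apply, Pi.smul_apply, smul_eq_mul, MulOpposite.smul_eq_mul_unop, MulOpposite.unop_op]
    have : u i = v i - w i := rfl
    field_simp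
    linear_combination (-u i) * huv - (u ⬝ᵥ u) * this

end Rotation

/-! ### From the absolute determinant to a radial integral -/

section AbsDet

open ProbabilityTheory WithLp Matrix

theorem integral_exp_neg_norm_sq {V : Type*} [NormedAddCommGroup V] [InnerProductSpace ℝ V]
    [FiniteDimensional ℝ V] [MeasurableSpace V] [BorelSpace V] :
    ∫ v : V, Real.exp (-‖v‖ ^ 2 / 2) = √(2 * Real.pi) ^ Module.finrank ℝ V := by
  have h := GaussianFourier.integral_rexp_neg_mul_sq_norm (V := V) (b := 1 / 2) (by norm_num)
  have h2 : Real.pi / (1 / 2) = 2 * Real.pi := by ring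
  rw [h2, show (Module.finrank ℝ V : ℝ) / 2 = 1 / 2 * Module.finrank ℝ V by ring,
    Real.rpow_mul (by positivity), Real.rpow_natCast, ← Real.sqrt_eq_rpow] at h
  rw [← h]
  congr 1
  ext v
  congr 1
  ring

variable {ι : Type*} [Fintype ι] [DecidableEq ι]

/-- The function `det M ^ 2 * exp (-½ ‖M v‖²)`, whose integral over `v` is `(2π)^{m/2} |det M|`. -/
noncomputable def detKernel (M : Matrix ι ι ℝ) (v : EuclideanSpace ℝ ι) : ℝ :=
  M.det ^ 2 * Real.exp (-(∑ i, (M *ᵥ v.ofLp) i ^ 2) / 2)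

theorem detKernel_eq (M : Matrix ι ι ℝ) (v : EuclideanSpace ℝ ι) :
    detKernel M v = M.det ^ 2 * Real.exp (-‖M.toEuclideanLin v‖ ^ 2 / 2) := by
  rw [detKernel, EuclideanSpace.real_norm_sq_eq]
  rfl

theorem map_toEuclideanLin {M : Matrix ι ι ℝ} (hM : M.det ≠ 0) :
    (volume : Measure (EuclideanSpace ℝ ι)).map M.toEuclideanLin =
      ENNReal.ofReal |M.det⁻¹| • volume := by
  have hd : LinearMap.det M.toEuclideanLin = M.det := by
    simp
  rw [← hd] at hM ⊢
  exact Measure.map_linearMap_addHaar_eq_smul_addHaar _ hM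

/-- For invertible M the change of variables by M leaves a factor 1/|det M|, and det² turns it into
|det M|. For singular M both sides vanish. -/
theorem integral_detKernel (M : Matrix ι ι ℝ) :
    ∫ v, detKernel M v = √(2 * Real.pi) ^ Fintype.card ι * |M.det| := by
  by_cases hM : M.det = 0
  · simp [detKernel, hM]
  have hm : AEMeasurable M.toEuclideanLin volume :=
    (LinearMap.continuous_of_finiteDimensional _).aemeasurable
  simp_rw [detKernel_eq]
  rw [integral_const_mul, ← integral_map (f := fun v => Real.exp (-‖v‖ ^ 2 / 2)) hm
    (Continuous.aestronglyMeasurable (by fun_prop)), map_toEuclideanLin hM, integral_smul_measure,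
    integral_exp_neg_norm_sq, finrank_euclideanSpace, ENNReal.toReal_ofReal (abs_nonneg _), ← sq_abs, abs_inv]
  have := abs_pos.2 hM
  rw [smul_eq_mul]
  field_simp

theorem integrable_detKernel (M : Matrix ι ι ℝ) : Integrable (detKernel M) := by
  by_cases hM : M.det = 0
  · have h : detKernel M = 0 := by
      ext v
      simp [detKernel, hM]
    exact h ▸ integrable_zero _ _ _
  -- A nonintegrable function has Bochner integral 0 by convention, so a nonzero value certifies
  -- integrability.
  refine .of_integral_ne_zero ?_
  rw [integral_detKernel]
  positivity

omit [Fintype ι] in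
theorem continuous_shiftedMatrix (μ : ℝ) : Continuous (shiftedMatrix (ι := ι) μ) :=
  continuous_matrix fun i j => by
    simp only [shiftedMatrix, Matrix.of_apply]
    fun_prop

theorem integrable_det_sq (μ : ℝ) :
    Integrable (fun g => (shiftedMatrix μ g).det ^ 2) (entryLaw ι) := by
  simpa [columnWeight] using integrable_det_sq_mul_columnWeight (c := fun _ : ι => 0) (by simp) μ

theorem integrable_abs_det (μ : ℝ) :
    Integrable (fun g => |(shiftedMatrix μ g).det|) (entryLaw ι) := by
  -- Domination by |t| ≤ 1 + t².
  refine ((integrable_const 1).add (integrable_det_sq μ)).mono'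
    ((continuous_shiftedMatrix μ).matrix_det.abs.aestronglyMeasurable) (.of_forall fun g => ?_)
  simp only [Real.norm_eq_abs, abs_abs, Pi.add_apply]
  rw [← sq_abs]
  nlinarith [sq_nonneg (|(shiftedMatrix μ g).det| - 1), abs_nonneg (shiftedMatrix μ g).det]

theorem continuous_detKernel (μ : ℝ) :
    Continuous fun p : (ι × ι → ℝ) × EuclideanSpace ℝ ι => detKernel (shiftedMatrix μ p.1) p.2 := by
  have h1 : Continuous fun p : (ι × ι → ℝ) × EuclideanSpace ℝ ι => shiftedMatrix μ p.1 :=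
    (continuous_shiftedMatrix μ).comp continuous_fst
  have h2 : Continuous fun p : (ι × ι → ℝ) × EuclideanSpace ℝ ι =>
      shiftedMatrix μ p.1 *ᵥ p.2.ofLp := h1.matrix_mulVec (by fun_prop)
  unfold detKernel
  have h3 := h1.matrix_det
  fun_prop

/-- This licenses Fubini. The kernel is nonnegative, so integrating out v reduces the claim to
integrability of |det|. -/
theorem integrable_prod_detKernel (μ : ℝ) :
    Integrable (fun p : (ι × ι → ℝ) × EuclideanSpace ℝ ι => detKernel (shiftedMatrix μ p.1) p.2)
      ((entryLaw ι).prod volume) := by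
  have hm : AEStronglyMeasurable (fun p : (ι × ι → ℝ) × EuclideanSpace ℝ ι =>
      detKernel (shiftedMatrix μ p.1) p.2) ((entryLaw ι).prod volume) :=
    (continuous_detKernel μ).aestronglyMeasurable
  have h : ∀ (g : ι × ι → ℝ) v, ‖detKernel (shiftedMatrix μ g) v‖ = detKernel (shiftedMatrix μ g) v :=
    fun g v => Real.norm_of_nonneg (by unfold detKernel; positivity)
  have hi : Integrable (fun g => ∫ v, ‖detKernel (shiftedMatrix μ g) v‖) (entryLaw ι) := by
    simp_rw [h, integral_detKernel]
    exact (integrable_abs_det μ).const_mul _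
  refine (integrable_prod_iff hm).2 ⟨?_, ?_⟩
  · exact .of_forall fun g => integrable_detKernel (shiftedMatrix μ g)
  · exact hi

theorem detKernel_conj {R : Matrix ι ι ℝ} (hR : Rᵀ * R = 1) (M : Matrix ι ι ℝ)
    (v : EuclideanSpace ℝ ι) :
    detKernel (R * M * Rᵀ) v = detKernel M (toLp 2 (Rᵀ *ᵥ v.ofLp)) := by
  have hd : (R * M * Rᵀ).det = M.det := by
    have := congrArg Matrix.det hR
    rw [Matrix.det_mul, Matrix.det_one] at this
    rw [Matrix.det_mul, Matrix.det_mul]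
    linear_combination M.det * this
  rw [detKernel, detKernel, hd, ← Matrix.mulVec_mulVec, ← Matrix.mulVec_mulVec, sum_sq_mulVec hR]

/-- Conjugating by an orthogonal R that sends ‖v‖ e_{i₀} to v changes neither the law nor the shift,
so only a single column need be weighted. -/
theorem integral_detKernel_shiftedMatrix [Nonempty ι] (μ : ℝ) (v : EuclideanSpace ℝ ι) :
    ∫ g, detKernel (shiftedMatrix μ g) v ∂entryLaw ι =
      radialMoment (Fintype.card ι) (μ ^ 2) ‖v‖ := by
  obtain ⟨i₀⟩ := ‹Nonempty ι›
  obtain ⟨R, hR, hv⟩ := exists_orthogonal_mulVec_eq (v := ‖v‖ • Pi.single i₀ 1) (w := v.ofLp) (by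
    have := EuclideanSpace.real_norm_sq_eq v
    rw [smul_dotProduct, dotProduct_smul, dotProduct_single, Pi.single_eq_same]
    simpa [dotProduct, sq] using this)
  have hv' : Rᵀ *ᵥ v.ofLp = ‖v‖ • Pi.single i₀ 1 := by
    rw [← hv, Matrix.mulVec_mulVec, hR, Matrix.one_mulVec]
  have hm : Measurable (conjEntries R) :=
    (LinearMap.continuous_of_finiteDimensional _).measurable
  have hc : Continuous fun g : ι × ι → ℝ => detKernel (shiftedMatrix μ g) v :=
    (continuous_detKernel μ).comp (by fun_prop : Continuous fun g : ι × ι → ℝ => (g, v))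
  rw [← integral_det_sq_mul_exp_column i₀, ← map_conjEntries hR, integral_map hm.aemeasurable
    hc.aestronglyMeasurable, map_conjEntries hR]
  simp_rw [shiftedMatrix_conjEntries hR, detKernel_conj hR, hv', detKernel, Matrix.mulVec_smul]
  simp [mul_pow, Finset.mul_sum]

/-- Fubini followed by polar coordinates; the constant is the dimension times the volume of the unit
ball. -/
theorem integral_abs_det_eq_integral_radialMoment [Nonempty ι] (μ : ℝ) :
    √(2 * Real.pi) ^ Fintype.card ι * ∫ g, |(shiftedMatrix μ g).det| ∂entryLaw ι =
      Fintype.card ι * (√Real.pi ^ Fintype.card ι / Real.Gamma (Fintype.card ι / 2 + 1)) *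
        ∫ r in Set.Ioi (0 : ℝ), r ^ (Fintype.card ι - 1) *
          radialMoment (Fintype.card ι) (μ ^ 2) r := by
  rw [← integral_const_mul]
  simp_rw [← integral_detKernel]
  rw [integral_integral_swap (integrable_prod_detKernel μ)]
  simp_rw [integral_detKernel_shiftedMatrix]
  rw [integral_fun_norm_addHaar volume (radialMoment (Fintype.card ι) (μ ^ 2)),
    finrank_euclideanSpace, Measure.real, EuclideanSpace.volume_ball, ENNReal.ofReal_one, one_pow,
    one_mul, ENNReal.toReal_ofReal (by positivity)]
  simp [mul_assoc]

end AbsDet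

/-! ### Evaluation of the radial integral by incomplete Gamma functions -/

section RadialIntegral

open Real Set Filter Topology

theorem hasDerivAt_mul_sqrt_inv (r : ℝ) :
    HasDerivAt (fun r : ℝ => r * √(1 + r ^ 2)⁻¹) (√(1 + r ^ 2)⁻¹ * (1 + r ^ 2)⁻¹) r := by
  have hp : 0 < 1 + r ^ 2 := by positivity
  have h1 : HasDerivAt (fun r : ℝ => (1 + r ^ 2)⁻¹) (-(2 * r) / (1 + r ^ 2) ^ 2) r := by
    have := ((hasDerivAt_pow 2 r).const_add 1).inv hp.ne'
    exact this.congr_deriv (by simp)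
  have h2 := (hasDerivAt_id r).mul (h1.sqrt (inv_pos.2 hp).ne')
  refine h2.congr_deriv ?_
  have hs : √(1 + r ^ 2)⁻¹ ≠ 0 := by positivity
  have hs2 : √(1 + r ^ 2)⁻¹ ^ 2 = (1 + r ^ 2)⁻¹ := Real.sq_sqrt (by positivity)
  generalize √(1 + r ^ 2)⁻¹ = q at *
  simp only [id, one_mul]
  field_simp
  rw [hs2]
  field_simp
  ring

theorem sq_mul_sqrt_inv (r : ℝ) : (r * √(1 + r ^ 2)⁻¹) ^ 2 = 1 - (1 + r ^ 2)⁻¹ := by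
  have hp : 0 < 1 + r ^ 2 := by positivity
  rw [mul_pow, Real.sq_sqrt (by positivity)]
  field_simp
  ring

theorem image_mul_sqrt_inv : (fun r : ℝ => r * √(1 + r ^ 2)⁻¹) '' Ioi 0 = Ioo 0 1 := by
  ext w
  constructor
  · rintro ⟨r, hr, rfl⟩
    have hr' : (0 : ℝ) < r := hr
    have hp : 0 < (1 + r ^ 2)⁻¹ := by positivity
    refine ⟨by positivity, ?_⟩
    have := sq_mul_sqrt_inv r
    exact (sq_lt_one_iff₀ (by positivity)).1 (by linarith)
  · rintro ⟨h0, h1⟩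
    have hp : 0 < 1 - w ^ 2 := by nlinarith
    refine ⟨w / √(1 - w ^ 2), div_pos h0 (by positivity), ?_⟩
    have : (1 + (w / √(1 - w ^ 2)) ^ 2)⁻¹ = 1 - w ^ 2 := by
      rw [div_pow, Real.sq_sqrt hp.le]
      field_simp
      ring
    simp only [this]
    field_simp

theorem injOn_mul_sqrt_inv : InjOn (fun r : ℝ => r * √(1 + r ^ 2)⁻¹) (Ioi 0) := by
  refine (strictMono_of_hasDerivAt_pos hasDerivAt_mul_sqrt_inv fun r => ?_).injective.injOn
  positivity

/-- Substitute w = r/√(1+r²), so that 1 - 1/(1+r²) = w². Of the m + 1 factors 1/√(1+r²), m turn r^m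
into w^m; the last one, together with 1/(1+r²), is dw/dr. -/
theorem integral_radialMoment_eq_integral_Ioo (m : ℕ) (x : ℝ) :
    ∫ r in Ioi (0 : ℝ), r ^ m * radialMoment (m + 1) x r =
      ∫ w in Ioo (0 : ℝ) 1, w ^ m * exp (-(x * w ^ 2) / 2) *
        (expPoly (m + 1) x - x * w ^ 2 * expPoly m x) := by
  rw [← image_mul_sqrt_inv, integral_image_eq_integral_abs_deriv_smul measurableSet_Ioi
    (fun r _ => (hasDerivAt_mul_sqrt_inv r).hasDerivWithinAt) injOn_mul_sqrt_inv]
  refine setIntegral_congr_fun measurableSet_Ioi fun r _ => ?_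
  have hp : 0 < √(1 + r ^ 2)⁻¹ * (1 + r ^ 2)⁻¹ := by positivity
  simp only [sq_mul_sqrt_inv, abs_of_pos hp, radialMoment, smul_eq_mul,
    Nat.add_sub_cancel]
  rw [mul_pow]
  ring

/-- By `expPoly_succ` the terms containing `expPoly m x` form an exact derivative, that of w^(m+1)
exp(-xw²/2) up to this factor. Only x^(m+1) w^m exp(-xw²/2) is left to integrate. -/
theorem integral_radialMoment (m : ℕ) (x : ℝ) :
    ∫ r in Ioi (0 : ℝ), r ^ m * radialMoment (m + 1) x r =
      exp (-x / 2) * expPoly m x +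
        x ^ (m + 1) * ∫ w in Ioo (0 : ℝ) 1, w ^ m * exp (-(x * w ^ 2) / 2) := by
  rw [integral_radialMoment_eq_integral_Ioo, ← integral_Ioc_eq_integral_Ioo,
    ← integral_Ioc_eq_integral_Ioo, ← intervalIntegral.integral_of_le zero_le_one,
    ← intervalIntegral.integral_of_le zero_le_one, ← intervalIntegral.integral_const_mul]
  have hd : ∀ w : ℝ, HasDerivAt (fun w => expPoly m x * (w ^ (m + 1) * exp (-(x * w ^ 2) / 2)))
      (expPoly m x * (((m + 1 : ℝ) * w ^ m - x * w ^ (m + 2)) * exp (-(x * w ^ 2) / 2))) w := by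
    intro w
    have h1 : HasDerivAt (fun w : ℝ => -(x * w ^ 2) / 2) (-(x * w)) w := by
      refine ((((hasDerivAt_pow 2 w).const_mul x).neg).div_const 2).congr_deriv ?_
      simp
      ring
    refine (((hasDerivAt_pow (m + 1) w).mul h1.exp).const_mul _).congr_deriv ?_
    push_cast
    ring
  have hF := intervalIntegral.integral_eq_sub_of_hasDerivAt (a := 0) (b := 1) (fun w _ => hd w)
    (Continuous.intervalIntegrable (by fun_prop) _ _)
  have hsplit : exp (-x / 2) * expPoly m x = ∫ w in (0 : ℝ)..1,
      expPoly m x * (((m + 1 : ℝ) * w ^ m - x * w ^ (m + 2)) * exp (-(x * w ^ 2) / 2)) := by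
    rw [hF]
    simp [mul_comm]
  rw [hsplit, ← intervalIntegral.integral_add (Continuous.intervalIntegrable (by fun_prop) _ _)
    (Continuous.intervalIntegrable (by fun_prop) _ _)]
  refine intervalIntegral.integral_congr fun w _ => ?_
  simp only [expPoly_succ]
  ring

theorem lowerGamma_eq_integral_Ioo (m : ℕ) {y : ℝ} (hy : 0 < y) :
    lowerGamma ((m + 1 : ℝ) / 2) y =
      2 * y ^ ((m + 1 : ℝ) / 2) * ∫ w in Ioo (0 : ℝ) 1, w ^ m * exp (-(y * w ^ 2)) := by
  have himg : (fun w : ℝ => y * w ^ 2) '' Ioo 0 1 = Ioo 0 y := by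
    ext t
    constructor
    · rintro ⟨w, ⟨h0, h1⟩, rfl⟩
      refine ⟨by positivity, ?_⟩
      have : w ^ 2 < 1 := by nlinarith
      nlinarith
    · rintro ⟨h0, h1⟩
      refine ⟨√(t / y), ⟨by positivity, ?_⟩, ?_⟩
      · rw [Real.sqrt_lt' one_pos, one_pow, div_lt_one hy]
        exact h1
      · simp only
        rw [Real.sq_sqrt (by positivity)]
        field_simp
  have hinj : InjOn (fun w : ℝ => y * w ^ 2) (Ioo 0 1) := by
    intro a ha b hb hab
    have h := mul_left_cancel₀ hy.ne' hab
    exact (pow_left_inj₀ ha.1.le hb.1.le two_ne_zero).1 h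
  have hd : ∀ w ∈ Ioo (0 : ℝ) 1, HasDerivWithinAt (fun w : ℝ => y * w ^ 2) (2 * y * w) (Ioo 0 1) w :=
    fun w _ => (((hasDerivAt_pow 2 w).const_mul y).congr_deriv (by simp; ring)).hasDerivWithinAt
  rw [lowerGamma, integral_Ioc_eq_integral_Ioo, ← himg,
    integral_image_eq_integral_abs_deriv_smul measurableSet_Ioo hd hinj, ← integral_const_mul]
  refine setIntegral_congr_fun measurableSet_Ioo fun w hw => ?_
  have hw0 : 0 < w := hw.1
  have h1 : (y * w ^ 2) ^ ((m + 1 : ℝ) / 2 - 1) = y ^ ((m + 1 : ℝ) / 2) / y * (w ^ m / w) := by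
    rw [Real.mul_rpow hy.le (by positivity), Real.rpow_sub_one hy.ne', ← Real.rpow_natCast w 2,
      ← Real.rpow_mul hw0.le]
    congr 1
    rw [← Real.rpow_natCast w m, ← Real.rpow_sub_one hw0.ne']
    congr 1
    push_cast
    ring
  simp only [smul_eq_mul, abs_of_pos (by positivity : 0 < 2 * y * w), h1]
  field_simp

/-- The derivative of `expPoly m` is `expPoly m` minus t^m, so -exp(-t) times it is an
antiderivative of t^m exp(-t), vanishing at infinity. -/
theorem upperGamma_eq (m : ℕ) (x : ℝ) :
    upperGamma (m + 1 : ℝ) x = exp (-x) * expPoly m x := by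
  have hI : IntegrableOn (fun t : ℝ => t ^ m * exp (-t)) (Ioi x) := by
    -- The rate 1/2 leaves half of the exponential decay to absorb t^m.
    have h := integrable_of_isBigO_exp_neg (f := fun t : ℝ => t ^ m * exp (-t)) (a := x)
      (b := 1 / 2) (by norm_num) (by fun_prop) ?_
    · exact h
    · have h2 := (isLittleO_pow_exp_pos_mul_atTop (k := m) (b := 1 / 2) (by norm_num)).isBigO.mul
        (Asymptotics.isBigO_refl (fun t : ℝ => exp (-t)) atTop)
      refine h2.congr_right fun t => ?_
      rw [← Real.exp_add]
      congr 1
      ring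
  have hd : ∀ (m : ℕ) (t : ℝ), HasDerivAt (fun t => -(exp (-t) * expPoly m t))
      (t ^ m * exp (-t)) t := by
    intro m t
    have he : HasDerivAt (fun t : ℝ => exp (-t)) (-exp (-t)) t := by
      simpa using (hasDerivAt_neg t).exp
    induction m with
    | zero =>
      refine (he.neg.congr_deriv (by simp)).congr_of_eventuallyEq (.of_forall fun t => ?_)
      simp [expPoly]
    | succ k ih =>
      simp only [expPoly_succ]
      refine (((ih.neg.const_mul (k + 1 : ℝ)).add (he.mul (hasDerivAt_pow (k + 1) t))).neg.congr_deriv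
        ?_).congr_of_eventuallyEq (.of_forall fun t => ?_)
      · push_cast
        ring
      · simp
        ring
  have ht : Tendsto (fun t => -(exp (-t) * expPoly m t)) atTop (𝓝 0) := by
    rw [← neg_zero]
    refine Tendsto.neg ?_
    simp only [expPoly, Finset.mul_sum]
    rw [← Finset.sum_const_zero (s := Finset.range (m + 1))]
    refine tendsto_finsetSum _ fun j _ => ?_
    have := (tendsto_pow_mul_exp_neg_atTop_nhds_zero j).const_mul
      ((m.choose j : ℝ) * (m - j).factorial)
    rw [mul_zero] at this
    exact this.congr fun t => by ring
  have h := integral_Ioi_of_hasDerivAt_of_tendsto' (fun t _ => hd m t) hI ht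
  rw [upperGamma]
  simp only [add_sub_cancel_right, Real.rpow_natCast]
  rw [h]
  ring

end RadialIntegral

/-! ### Closed form of the mean absolute determinant -/

section MeanAbsDet

open Real

/-- Legendre duplication at (m+1)/2. One power of √(2π) comes from `integral_detKernel`, the other
from normalizing the Gaussian density on the fiber. -/
theorem gaussian_constant (m : ℕ) :
    (√(2 * π) ^ (m + 1))⁻¹ * ((√(2 * π) ^ (m + 1))⁻¹ *
      ((m + 1 : ℝ) * (√π ^ (m + 1) / Gamma ((m + 1 : ℝ) / 2 + 1)))) =
        Gamma ((m + 2 : ℝ) / 2) / √π ^ (m + 2) / Gamma (m + 1 : ℝ) := by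
  have hdup := Real.Gamma_mul_Gamma_add_half ((m + 1 : ℝ) / 2)
  have e1 : 2 * ((m + 1 : ℝ) / 2) = m + 1 := by ring
  have e2 : (m + 1 : ℝ) / 2 + 1 / 2 = (m + 2) / 2 := by ring
  have e3 : (2 : ℝ) ^ (1 - (m + 1 : ℝ)) = ((2 : ℝ) ^ m)⁻¹ := by
    rw [← Real.rpow_natCast, ← Real.rpow_neg (by norm_num)]
    congr 1
    ring
  rw [e1, e2, e3] at hdup
  rw [Real.Gamma_add_one (by positivity)]
  have hG1 : 0 < Gamma ((m + 1 : ℝ) / 2) := Real.Gamma_pos_of_pos (by positivity)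
  have hG2 : 0 < Gamma (m + 1 : ℝ) := Real.Gamma_pos_of_pos (by positivity)
  have hG3 : Gamma ((m + 2 : ℝ) / 2) =
      Gamma (m + 1 : ℝ) * ((2 : ℝ) ^ m)⁻¹ * √π / Gamma ((m + 1 : ℝ) / 2) := by
    rw [← hdup]
    field_simp
  have hs : √(2 * π) ^ (m + 1) * √(2 * π) ^ (m + 1) = 2 ^ (m + 1) * (√π ^ (m + 1) * √π ^ (m + 1)) := by
    rw [← mul_pow, ← mul_pow, ← mul_pow, Real.mul_self_sqrt (by positivity),
      Real.mul_self_sqrt (by positivity)]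
  rw [hG3, ← mul_assoc, ← mul_inv, hs]
  have hp : 0 < √π := by positivity
  field_simp
  ring

theorem integral_abs_det_shiftedMatrix (m : ℕ) (μ : ℝ) :
    (√(2 * π) ^ (m + 1))⁻¹ *
        ∫ g, |(shiftedMatrix μ g).det| ∂entryLaw (Fin (m + 1)) =
      Gamma ((m + 2 : ℝ) / 2) / √π ^ (m + 2) *
        (exp (μ ^ 2 / 2) * (upperGamma (m + 1 : ℝ) (μ ^ 2) / Gamma (m + 1 : ℝ)) +
          2 ^ m * (μ ^ 2 / 2) ^ ((m + 1 : ℝ) / 2) *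
            (lowerGamma ((m + 1 : ℝ) / 2) (μ ^ 2 / 2) / Gamma (m + 1 : ℝ))) := by
  have h := integral_abs_det_eq_integral_radialMoment (ι := Fin (m + 1)) μ
  simp only [Fintype.card_fin, Nat.add_sub_cancel, Nat.cast_add, Nat.cast_one] at h
  rw [integral_radialMoment] at h
  have hc := gaussian_constant m
  have hup : exp (-μ ^ 2 / 2) * expPoly m (μ ^ 2) =
      exp (μ ^ 2 / 2) * upperGamma (m + 1 : ℝ) (μ ^ 2) := by
    rw [upperGamma_eq, ← mul_assoc, ← Real.exp_add]
    congr 2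
    ring
  have hlow : (μ ^ 2) ^ (m + 1) * (∫ w in Set.Ioo (0 : ℝ) 1, w ^ m * exp (-(μ ^ 2 * w ^ 2) / 2)) =
      2 ^ m * (μ ^ 2 / 2) ^ ((m + 1 : ℝ) / 2) * lowerGamma ((m + 1 : ℝ) / 2) (μ ^ 2 / 2) := by
    -- Both sides vanish at μ = 0, where the substitution behind `lowerGamma_eq_integral_Ioo` is
    -- degenerate.
    by_cases hμ : μ = 0
    · subst hμ
      rw [zero_pow two_ne_zero, zero_div, Real.zero_rpow (by positivity)]
      simp
    have hy : 0 < μ ^ 2 / 2 := by positivity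
    rw [lowerGamma_eq_integral_Ioo m hy]
    have h1 : (μ ^ 2 / 2) ^ ((m + 1 : ℝ) / 2) * (μ ^ 2 / 2) ^ ((m + 1 : ℝ) / 2) =
        (μ ^ 2 / 2) ^ (m + 1) := by
      rw [← Real.rpow_add hy, ← Real.rpow_natCast (μ ^ 2 / 2)]
      congr 1
      push_cast
      ring
    have h2 : ∀ w : ℝ, -(μ ^ 2 / 2 * w ^ 2) = -(μ ^ 2 * w ^ 2) / 2 := fun w => by ring
    simp_rw [h2]
    have h3 : (μ ^ 2) ^ (m + 1) = 2 ^ m * 2 * (μ ^ 2 / 2) ^ (m + 1) := by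
      rw [← pow_succ, ← mul_pow, mul_div_cancel₀ _ two_ne_zero]
    rw [h3, ← h1]
    ring
  rw [hup, hlow] at h
  have hp : √(2 * π) ^ (m + 1) ≠ 0 := by positivity
  rw [← eq_inv_mul_iff_mul_eq₀ hp] at h
  rw [h]
  linear_combination (exp (μ ^ 2 / 2) * upperGamma (m + 1 : ℝ) (μ ^ 2) +
    2 ^ m * (μ ^ 2 / 2) ^ ((m + 1 : ℝ) / 2) * lowerGamma ((m + 1 : ℝ) / 2) (μ ^ 2 / 2)) * hc

end MeanAbsDet

/-! ### Bombieri–Weyl coordinates and dimensions -/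

section BombieriWeylCoordinates

open MvPolynomial WithLp

variable {n d : ℕ}

theorem mem_exponents {α : Fin n →₀ ℕ} : α ∈ exponents n d ↔ α.degree = d := by
  simp [exponents, Finset.mem_finsuppAntidiag, Finsupp.degree_eq_sum]

/-- The polynomial with prescribed Bombieri-Weyl coordinates. -/
noncomputable def HomPoly.ofCoords (a : (Fin n →₀ ℕ) → ℝ) : HomPoly n d :=
  ⟨∑ α ∈ exponents n d, monomial α (a α * √(α.multinomial : ℝ)),
    Submodule.sum_mem _ fun _ hα => isHomogeneous_monomial _ (mem_exponents.1 hα)⟩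

theorem sqrt_multinomial_ne_zero (α : Fin n →₀ ℕ) : √(α.multinomial : ℝ) ≠ 0 := by
  have : 0 < α.multinomial := Nat.multinomial_pos _ _
  positivity

theorem HomPoly.bwCoord_ofCoords (a : (Fin n →₀ ℕ) → ℝ) {α : Fin n →₀ ℕ}
    (hα : α ∈ exponents n d) : (HomPoly.ofCoords a : HomPoly n d).bwCoord α = a α := by
  have h : HomPoly.toPoly n d (HomPoly.ofCoords a) =
      ∑ α ∈ exponents n d, monomial α (a α * √(α.multinomial : ℝ)) := rfl
  rw [bwCoord, h, coeff_sum]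
  simp only [coeff_monomial, Finset.sum_ite_eq', hα, if_true]
  rw [mul_div_cancel_right₀ _ (sqrt_multinomial_ne_zero α)]

theorem HomPoly.ext_bwCoord {f g : HomPoly n d}
    (h : ∀ α ∈ exponents n d, f.bwCoord α = g.bwCoord α) : f = g := by
  refine Subtype.ext ((f.eq_sum_bwCoord).trans (Eq.trans ?_ g.eq_sum_bwCoord.symm))
  exact Finset.sum_congr rfl fun α hα => by rw [h α hα]

theorem HomPoly.norm_sq_eq (f : HomPoly n d) :
    ‖f‖ ^ 2 = ∑ α ∈ exponents n d, f.bwCoord α ^ 2 := by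
  rw [← real_inner_self_eq_norm_sq]
  simp_rw [sq]
  rfl

theorem HomPoly.bwCoord_sub (f g : HomPoly n d) (α : Fin n →₀ ℕ) :
    (f - g).bwCoord α = f.bwCoord α - g.bwCoord α := by
  simp [bwCoord, sub_div]

theorem HomPoly.finrank_eq : Module.finrank ℝ (HomPoly n d) = (exponents n d).card := by
  let T : HomPoly n d →ₗ[ℝ] (exponents n d → ℝ) :=
    { toFun := fun f α => f.bwCoord α
      map_add' := fun f g => by ext; simp [bwCoord, add_div]
      map_smul' := fun r f => by ext; simp [bwCoord, mul_div_assoc] }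
  have hT : Function.Bijective T := by
    refine ⟨fun f g h => HomPoly.ext_bwCoord fun α hα => congrFun h ⟨α, hα⟩, fun a => ?_⟩
    refine ⟨HomPoly.ofCoords fun α => if h : α ∈ exponents n d then a ⟨α, h⟩ else 0, ?_⟩
    ext ⟨α, hα⟩
    exact (HomPoly.bwCoord_ofCoords _ hα).trans (by simp [hα])
  rw [(LinearEquiv.ofBijective T hT).finrank_eq, Module.finrank_fintype_fun_eq_card,
    Fintype.card_coe]

theorem PolySystem.finrank_eq :
    Module.finrank ℝ (PolySystem n d) = n * (exponents n d).card := by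
  rw [(WithLp.linearEquiv 2 ℝ (Fin n → HomPoly n d)).finrank_eq, Module.finrank_pi_fintype]
  simp [HomPoly.finrank_eq]

end BombieriWeylCoordinates

/-! ### The fiber over e_1 as a Euclidean space -/

section FiberParametrization

open MvPolynomial WithLp Finsupp

variable {k d : ℕ}

/-- The exponents other than that of `X_0 ^ d`. -/
noncomputable def freeExponents (k d : ℕ) : Finset (Fin (k + 1) →₀ ℕ) :=
  (exponents (k + 1) d).erase (single 0 d)

theorem single_mem_exponents : single (0 : Fin (k + 1)) d ∈ exponents (k + 1) d :=
  mem_exponents.2 (by simp)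

/-- The free Bombieri-Weyl coordinates of a system in the fiber over `(e_1, lam)`. -/
abbrev FreeCoords (k d : ℕ) : Type := EuclideanSpace ℝ (Fin (k + 1) × freeExponents k d)

/-- The parametrization of the fiber over `(e_1, lam)` by the free coordinates. -/
noncomputable def fiberParam (lam : ℝ) (y : FreeCoords k d) : PolySystem (k + 1) d :=
  toLp 2 fun i => HomPoly.ofCoords fun α =>
    if h : α ∈ freeExponents k d then y (i, ⟨α, h⟩) else if i = 0 then lam else 0

theorem bwCoord_fiberParam_free (lam : ℝ) (y : FreeCoords k d) (i : Fin (k + 1))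
    (α : freeExponents k d) : (fiberParam lam y i).bwCoord α = y (i, α) :=
  (HomPoly.bwCoord_ofCoords _ (Finset.mem_of_mem_erase α.2)).trans (by simp)

theorem bwCoord_fiberParam_single (lam : ℝ) (y : FreeCoords k d) (i : Fin (k + 1)) :
    (fiberParam lam y i).bwCoord (single 0 d) = if i = 0 then lam else 0 :=
  (HomPoly.bwCoord_ofCoords _ single_mem_exponents).trans (by simp [freeExponents])

theorem sum_exponents_eq (F : (Fin (k + 1) →₀ ℕ) → ℝ) :
    ∑ α ∈ exponents (k + 1) d, F α = F (single 0 d) + ∑ α : freeExponents k d, F α := by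
  rw [← Finset.add_sum_erase _ _ single_mem_exponents, Finset.sum_coe_sort (freeExponents k d) F]
  rfl

theorem norm_sq_fiberParam (lam : ℝ) (y : FreeCoords k d) :
    ‖fiberParam lam y‖ ^ 2 = ‖y‖ ^ 2 + lam ^ 2 := by
  rw [PiLp.norm_sq_eq_of_L2, EuclideanSpace.real_norm_sq_eq, Fintype.sum_prod_type]
  simp_rw [HomPoly.norm_sq_eq, sum_exponents_eq, bwCoord_fiberParam_free,
    bwCoord_fiberParam_single, Finset.sum_add_distrib]
  simp [ite_pow, add_comm]

theorem isometry_fiberParam (lam : ℝ) : Isometry (fiberParam (k := k) (d := d) lam) := by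
  refine Isometry.of_dist_eq fun y z => ?_
  rw [dist_eq_norm, dist_eq_norm, ← sq_eq_sq₀ (norm_nonneg _) (norm_nonneg _),
    PiLp.norm_sq_eq_of_L2, EuclideanSpace.real_norm_sq_eq, Fintype.sum_prod_type]
  simp [HomPoly.norm_sq_eq, sum_exponents_eq, HomPoly.bwCoord_sub, bwCoord_fiberParam_free,
    bwCoord_fiberParam_single]

/-- Any other monomial of degree e contains a variable that vanishes at e_1. Used in degree d for
the fiber equation and in degree d - 1 for partial derivatives. -/
theorem eval_single_of_isHomogeneous {p : MvPolynomial (Fin (k + 1)) ℝ} {e : ℕ}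
    (hp : p.IsHomogeneous e) :
    eval (fun j => if j = 0 then 1 else 0) p = coeff (single 0 e) p := by
  rw [eval_eq']
  have h0 : ∀ α : Fin (k + 1) →₀ ℕ, coeff α p ≠ 0 → α ≠ single 0 e →
      ∏ i, (if i = 0 then (1 : ℝ) else 0) ^ α i = 0 := by
    intro α hα hne
    by_contra hprod
    refine hne ?_
    have hz : ∀ i, i ≠ 0 → α i = 0 := by
      intro i hi
      by_contra hαi
      exact hprod (Finset.prod_eq_zero (Finset.mem_univ i) (by simp [hi, hαi]))
    have hdeg : α.degree = e := by
      rw [Finsupp.degree_eq_weight_one]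
      exact hp hα
    rw [Finsupp.degree_eq_sum, Finset.sum_eq_single 0 (fun i _ hi => hz i hi) (by simp)] at hdeg
    ext i
    by_cases hi : i = 0
    · simp [hi, hdeg]
    · rw [hz i hi, Finsupp.single_eq_of_ne hi]
  rw [Finset.sum_eq_single (single 0 e)]
  · rw [Finset.prod_eq_single 0 (fun i _ hi => by simp [hi]) (by simp)]
    simp
  · intro α hα hne
    rw [h0 α (MvPolynomial.mem_support_iff.1 hα) hne, mul_zero]
  · intro h
    rw [MvPolynomial.notMem_support_iff.1 h, zero_mul]

theorem e1_coe_apply (j : Fin (k + 1)) :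
    ((e1 (k + 1) : E (k + 1)) j) = if j = 0 then 1 else 0 := by
  simp [e1]

theorem evalAt_e1 (f : PolySystem (k + 1) d) (i : Fin (k + 1)) :
    f.evalAt (e1 (k + 1) : E (k + 1)) i = (f i).bwCoord (single 0 d) := by
  have hm : (single (0 : Fin (k + 1)) d).multinomial = 1 := by
    rw [Finsupp.multinomial_eq_of_support_subset (Finsupp.support_single_subset)]
    exact Nat.multinomial_singleton _ _
  simp only [PolySystem.evalAt, e1_coe_apply, HomPoly.bwCoord, hm, Nat.cast_one, Real.sqrt_one,
    div_one]
  exact eval_single_of_isHomogeneous (f i).2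

theorem mem_fiber_iff {lam : ℝ} {f : PolySystem (k + 1) d} :
    f ∈ fiber (e1 (k + 1)) lam ↔ ∀ i, (f i).bwCoord (single 0 d) = if i = 0 then lam else 0 := by
  have h : f ∈ fiber (e1 (k + 1)) lam ↔
      f.evalAt (e1 (k + 1) : E (k + 1)) = lam • (e1 (k + 1) : E (k + 1)) := Iff.rfl
  rw [h, PiLp.ext_iff]
  refine forall_congr' fun i => ?_
  rw [evalAt_e1, PiLp.smul_apply, e1_coe_apply]
  simp

theorem range_fiberParam (lam : ℝ) :
    Set.range (fiberParam (k := k) (d := d) lam) = fiber (e1 (k + 1)) lam := by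
  ext f
  rw [mem_fiber_iff]
  constructor
  · rintro ⟨y, rfl⟩ i
    exact bwCoord_fiberParam_single lam y i
  · intro h
    refine ⟨toLp 2 fun p => (f p.1).bwCoord p.2, PiLp.ext fun i => HomPoly.ext_bwCoord fun α hα => ?_⟩
    by_cases hα' : α = single 0 d
    · rw [hα', bwCoord_fiberParam_single, h]
    · exact bwCoord_fiberParam_free _ _ _ ⟨α, Finset.mem_erase.2 ⟨hα', hα⟩⟩

theorem finrank_freeCoords :
    Module.finrank ℝ (FreeCoords k d) = Module.finrank ℝ (PolySystem (k + 1) d) - (k + 1) := by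
  rw [PolySystem.finrank_eq, finrank_euclideanSpace, Fintype.card_prod, Fintype.card_fin,
    Fintype.card_coe, freeExponents, Finset.card_erase_of_mem single_mem_exponents, Nat.mul_sub,
    mul_one]

theorem finrank_polySystem :
    Module.finrank ℝ (PolySystem (k + 1) d) = Module.finrank ℝ (FreeCoords k d) + (k + 1) := by
  -- Without a nonempty exponent set the natural subtraction in `finrank_freeCoords` could truncate.
  have h : 0 < (exponents (k + 1) d).card := Finset.card_pos.2 ⟨_, single_mem_exponents⟩
  have := Nat.le_mul_of_pos_right (k + 1) h
  rw [finrank_freeCoords, PolySystem.finrank_eq]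
  omega

/-- An isometry transports normalized Hausdorff measure to its restriction to the range, and in the
full dimension of the parameter space that measure is Lebesgue measure. -/
theorem fiberMeasure_eq_map (lam : ℝ) :
    fiberMeasure (d := d) (e1 (k + 1)) lam = (volume : Measure (FreeCoords k d)).map
      (fiberParam lam) := by
  rw [fiberMeasure, ← finrank_freeCoords, ← range_fiberParam,
    ← (isometry_fiberParam lam).map_euclideanHausdorffMeasure,
    InnerProductSpace.euclideanHausdorffMeasure_eq_volume]

theorem measurableEmbedding_fiberParam (lam : ℝ) :
    MeasurableEmbedding (fiberParam (k := k) (d := d) lam) :=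
  (isometry_fiberParam lam).isClosedEmbedding.measurableEmbedding

end FiberParametrization

/-! ### The standard Gaussian: density and coordinate marginals -/

section GaussianDensity

open ProbabilityTheory WithLp

variable {V : Type*} [NormedAddCommGroup V] [InnerProductSpace ℝ V] [FiniteDimensional ℝ V]
  [MeasurableSpace V] [BorelSpace V]

omit [FiniteDimensional ℝ V] [MeasurableSpace V] [BorelSpace V] in
theorem stdNormalDensity_nonneg (z : V) : 0 ≤ stdNormalDensity V z := by
  unfold stdNormalDensity; positivity

omit [FiniteDimensional ℝ V] [MeasurableSpace V] [BorelSpace V] in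
theorem continuous_stdNormalDensity : Continuous (stdNormalDensity V) := by
  unfold stdNormalDensity; fun_prop

theorem integral_stdNormalDensity : ∫ z, stdNormalDensity V z = 1 := by
  simp_rw [stdNormalDensity]
  rw [integral_const_mul, integral_exp_neg_norm_sq, inv_mul_cancel₀ (by positivity)]

/-- Two finite measures with the same characteristic function coincide. -/
theorem stdGaussian_eq_withDensity :
    stdGaussian V = volume.withDensity fun z => ENNReal.ofReal (stdNormalDensity V z) := by
  have hint : Integrable (stdNormalDensity V) :=
    .of_integral_ne_zero (by rw [integral_stdNormalDensity]; exact one_ne_zero)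
  have : IsFiniteMeasure (volume.withDensity fun z => ENNReal.ofReal (stdNormalDensity V z)) :=
    isFiniteMeasure_withDensity_ofReal hint.2
  refine Measure.ext_of_charFun (funext fun t => ?_)
  rw [charFun_stdGaussian, charFun_apply, integral_withDensity_eq_integral_toReal_smul
    (continuous_stdNormalDensity.measurable.ennreal_ofReal) (.of_forall fun _ => ENNReal.ofReal_lt_top)]
  have h := fun t : V => GaussianFourier.integral_cexp_neg_mul_sq_norm_add (V := V) (b := 1 / 2)
    (by norm_num) Complex.I t
  -- The case t = 0 of the Fourier integral identifies the complex power with the real normalizing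
  -- constant.
  have h0 : (Real.pi / (1 / 2) : ℂ) ^ (Module.finrank ℝ V / 2 : ℂ) =
      ((√(2 * Real.pi) ^ Module.finrank ℝ V : ℝ) : ℂ) := by
    have h0 := h 0
    simp only [inner_zero_left, norm_zero, Complex.ofReal_zero, mul_zero, add_zero] at h0
    rw [← integral_exp_neg_norm_sq, ← integral_complex_ofReal]
    refine Eq.trans ?_ (h0.symm.trans (integral_congr_ae (.of_forall fun v => ?_)))
    · simp
    · push_cast
      congr 1
      ring
  have hc : ∀ x : V, (ENNReal.ofReal (stdNormalDensity V x)).toReal •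
      Complex.exp (inner ℝ x t * Complex.I) =
        ((√(2 * Real.pi) ^ Module.finrank ℝ V : ℝ) : ℂ)⁻¹ *
          Complex.exp (-(1 / 2) * ‖x‖ ^ 2 + Complex.I * inner ℝ t x) := by
    intro x
    rw [ENNReal.toReal_ofReal (stdNormalDensity_nonneg x), stdNormalDensity, Complex.real_smul,
      Complex.ofReal_mul, Complex.ofReal_inv, mul_assoc, Complex.ofReal_exp, ← Complex.exp_add,
      real_inner_comm]
    congr 2
    push_cast
    ring
  have hne : ((√(2 * Real.pi) ^ Module.finrank ℝ V : ℝ) : ℂ) ≠ 0 :=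
    Complex.ofReal_ne_zero.2 (by positivity)
  simp_rw [hc]
  rw [integral_const_mul, h, h0, inv_mul_cancel_left₀ hne, Complex.I_sq]
  congr 1
  ring

theorem map_comp_pi_of_injective {κ κ' : Type*} [Fintype κ] [Fintype κ'] {e : κ' → κ}
    (he : Function.Injective e) (μ : Measure ℝ) [IsProbabilityMeasure μ] :
    (Measure.pi fun _ : κ => μ).map (fun g p => g (e p)) = Measure.pi fun _ : κ' => μ := by
  have hi : iIndepFun (fun (p : κ') (g : κ → ℝ) => g (e p)) (Measure.pi fun _ => μ) :=
    (iIndepFun_pi (μ := fun _ : κ => μ) (X := fun _ => id) (fun _ => aemeasurable_id)).precomp he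
  have hm : ∀ p : κ', AEMeasurable (fun g : κ → ℝ => g (e p)) (Measure.pi fun _ => μ) :=
    fun p => (measurable_pi_apply (e p)).aemeasurable
  have h := (iIndepFun_iff_map_fun_eq_pi_map hm).1 hi
  refine h.trans ?_
  congr 1
  ext p : 1
  exact (measurePreserving_eval (fun _ : κ => μ) (e p)).map_eq

theorem map_stdGaussian_entries {κ ι : Type*} [Fintype κ] [Fintype ι] {e : ι × ι → κ}
    (he : Function.Injective e) :
    (stdGaussian (EuclideanSpace ℝ κ)).map (fun y p => y (e p)) = entryLaw ι := by
  rw [← map_pi_eq_stdGaussian, Measure.map_map (by fun_prop) (by fun_prop)]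
  exact map_comp_pi_of_injective he _

end GaussianDensity

/-! ### Derivative of the eigenvector map -/

section Derivative

open MvPolynomial WithLp

theorem hasFDerivAt_eval {n : ℕ} (p : MvPolynomial (Fin n) ℝ) (x : E n) :
    HasFDerivAt (fun x : E n => eval (fun j => x j) p)
      (∑ j, eval (fun j => x j) (pderiv j p) • (EuclideanSpace.proj j : E n →L[ℝ] ℝ)) x := by
  induction p using MvPolynomial.induction_on with
  | C a => simpa using hasFDerivAt_const a x
  | add p q hp hq =>
    simp only [map_add, add_smul, Finset.sum_add_distrib]
    exact hp.add hq
  | mul_X p i hp =>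
    have h := hp.mul (EuclideanSpace.proj i : E n →L[ℝ] ℝ).hasFDerivAt (x := x)
    simp only [map_mul, eval_X]
    refine h.congr_fderiv ?_
    ext y
    simp [pderiv_X, Pi.single_apply, Finset.sum_add_distrib, add_mul, Finset.mul_sum, apply_ite]
    ring_nf

theorem fderiv_eigenMap_apply {n d : ℕ} (f : PolySystem n d) (x y : E n) (t s : ℝ) (i : Fin n) :
    fderiv ℝ (eigenMap f) (x, t) (y, s) i =
      ∑ j, eval (fun j => x j) (pderiv j (HomPoly.toPoly n d (f i))) * y j -
        (t * y i + s * x i) := by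
  let D : Fin n → (E n × ℝ →L[ℝ] ℝ) := fun i =>
    (∑ j, eval (fun j => x j) (pderiv j (HomPoly.toPoly n d (f i))) •
      (EuclideanSpace.proj j : E n →L[ℝ] ℝ)) ∘L ContinuousLinearMap.fst ℝ (E n) ℝ -
    (t • (EuclideanSpace.proj i : E n →L[ℝ] ℝ) ∘L ContinuousLinearMap.fst ℝ (E n) ℝ +
      x i • ContinuousLinearMap.snd ℝ (E n) ℝ)
  have hF : HasFDerivAt (eigenMap f)
      ((PiLp.continuousLinearEquiv 2 ℝ fun _ : Fin n => ℝ).symm.toContinuousLinearMap ∘L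
        ContinuousLinearMap.pi D) (x, t) := by
    rw [← hasFDerivWithinAt_univ, hasFDerivWithinAt_piLp]
    intro i
    rw [hasFDerivWithinAt_univ]
    have h1 : HasFDerivAt (fun p : E n × ℝ => eval (fun j => p.1 j) (HomPoly.toPoly n d (f i))) _
        (x, t) := HasFDerivAt.comp (g := fun x : E n => eval (fun j => x j) (HomPoly.toPoly n d (f i)))
      (x, t) (hasFDerivAt_eval (HomPoly.toPoly n d (f i)) x)
      (ContinuousLinearMap.fst ℝ (E n) ℝ).hasFDerivAt
    have h2 : HasFDerivAt (fun p : E n × ℝ => p.2 * p.1 i) _ (x, t) :=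
      (ContinuousLinearMap.snd ℝ (E n) ℝ).hasFDerivAt.mul
        ((EuclideanSpace.proj i : E n →L[ℝ] ℝ) ∘L ContinuousLinearMap.fst ℝ (E n) ℝ).hasFDerivAt
    exact h1.sub h2
  rw [hF.fderiv]
  change D i (y, s) = _
  simp [D, mul_comm]

end Derivative

/-! ### The restricted derivative at e_1 as a shifted matrix -/

section RestrictedDerivative

open MvPolynomial WithLp Finsupp

variable {k d : ℕ}

/-- The exponent of the monomial `X_0 ^ (d - 1) X_{j + 1}`. -/
noncomputable def linearExponent (k d : ℕ) (j : Fin k) : Fin (k + 1) →₀ ℕ :=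
  single 0 (d - 1) + single j.succ 1

theorem linearExponent_mem (hd : 1 ≤ d) (j : Fin k) : linearExponent k d j ∈ freeExponents k d := by
  refine Finset.mem_erase.2 ⟨fun h => ?_, mem_exponents.2 ?_⟩
  · have := DFunLike.congr_fun h j.succ
    simp [linearExponent] at this
  · rw [linearExponent, map_add, Finsupp.degree_single, Finsupp.degree_single, Nat.sub_add_cancel hd]

theorem linearExponent_injective : Function.Injective (linearExponent k d) := by
  intro i j h
  have := DFunLike.congr_fun h i.succ
  by_contra hij
  simp [linearExponent, Ne.symm hij] at this

theorem multinomial_linearExponent (hd : 1 ≤ d) (j : Fin k) :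
    (linearExponent k d j).multinomial = d := by
  have hs : (linearExponent k d j).support ⊆ Finset.univ := Finset.subset_univ _
  have h := Nat.multinomial_spec Finset.univ (linearExponent k d j)
  rw [← Finsupp.multinomial_eq_of_support_subset hs, ← Finsupp.degree_eq_sum,
    mem_exponents.1 (Finset.mem_of_mem_erase (linearExponent_mem hd j)),
    Finset.prod_eq_single 0 (fun i _ hi => ?_) (by simp)] at h
  · have h0 : linearExponent k d j 0 = d - 1 := by simp [linearExponent]
    rw [h0, ← Nat.mul_factorial_pred (by omega : d ≠ 0), mul_comm d] at h
    exact Nat.eq_of_mul_eq_mul_left (Nat.factorial_pos _) h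
  · have : linearExponent k d j i ≤ 1 := by
      simp only [linearExponent, Finsupp.add_apply, Finsupp.single_eq_of_ne hi, zero_add,
        Finsupp.single_apply]
      split_ifs <;> omega
    exact Nat.factorial_eq_one.2 this

/-- At e_1 this partial derivative is the coefficient of X_0^(d-1) X_{j+1}, whose multinomial weight
is d!/(d-1)! = d. This is the source of √d. -/
theorem eval_pderiv_succ (hd : 1 ≤ d) (f : HomPoly (k + 1) d) (j : Fin k) :
    eval (fun j => if j = 0 then 1 else 0) (pderiv j.succ (HomPoly.toPoly (k + 1) d f)) =
      √d * f.bwCoord (linearExponent k d j) := by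
  have hf : (HomPoly.toPoly (k + 1) d f).IsHomogeneous d := f.2
  rw [eval_single_of_isHomogeneous hf.pderiv, coeff_pderiv, HomPoly.bwCoord,
    multinomial_linearExponent hd, linearExponent]
  have : √(d : ℝ) ≠ 0 := by positivity
  field_simp
  simp

theorem single_succ_mem_tangentSpace (j : Fin k) :
    (EuclideanSpace.single j.succ 1 : E (k + 1)) ∈ tangentSpace (e1 (k + 1) : E (k + 1)) := by
  rw [Submodule.mem_orthogonal_singleton_iff_inner_right]
  simp [e1, EuclideanSpace.inner_single_left]

/-- The orthonormal basis `(0, 1), (e_2, 0), …, (e_n, 0)` of `T_{e_1} × ℝ`. -/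
noncomputable def tangentVector (k : ℕ) :
    Fin (k + 1) → WithLp 2 (tangentSpace (e1 (k + 1) : E (k + 1)) × ℝ) :=
  Fin.cons (toLp 2 (0, 1))
    fun j => toLp 2 (⟨EuclideanSpace.single j.succ 1, single_succ_mem_tangentSpace j⟩, 0)

theorem orthonormal_tangentVector (k : ℕ) : Orthonormal ℝ (tangentVector k) := by
  rw [orthonormal_iff_ite]
  intro i j
  induction i using Fin.cases with
  | zero =>
    induction j using Fin.cases with
    | zero => simp [tangentVector]
    | succ j => simp [tangentVector, WithLp.prod_inner_apply, (Fin.succ_ne_zero j).symm]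
  | succ i =>
    induction j using Fin.cases with
    | zero => simp [tangentVector, WithLp.prod_inner_apply]
    | succ j =>
      simp [tangentVector, WithLp.prod_inner_apply, Submodule.coe_inner, Fin.succ_inj,
        EuclideanSpace.inner_single_left]

theorem finrank_tangentSpace_prod (k : ℕ) :
    Module.finrank ℝ (WithLp 2 (tangentSpace (e1 (k + 1) : E (k + 1)) × ℝ)) = k + 1 := by
  have : Fact (Module.finrank ℝ (E (k + 1)) = k + 1) := ⟨by simp⟩
  have h0 : (e1 (k + 1) : E (k + 1)) ≠ 0 := by
    intro h
    simpa [h] using e1_coe_apply (0 : Fin (k + 1))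
  rw [(WithLp.linearEquiv 2 ℝ _).finrank_eq, Module.finrank_prod,
    Submodule.finrank_orthogonal_span_singleton (n := k) h0, Module.finrank_self]

theorem exists_orthonormalBasis_tangentVector (k : ℕ) :
    ∃ b : OrthonormalBasis (Fin (k + 1)) ℝ (WithLp 2 (tangentSpace (e1 (k + 1) : E (k + 1)) × ℝ)),
      ⇑b = tangentVector k := by
  let b := basisOfOrthonormalOfCardEqFinrank (orthonormal_tangentVector k)
    (by rw [finrank_tangentSpace_prod, Fintype.card_fin])
  have hb : ⇑b = tangentVector k := coe_basisOfOrthonormalOfCardEqFinrank _ _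
  exact ⟨b.toOrthonormalBasis (by rw [hb]; exact orthonormal_tangentVector k), by simp [hb]⟩

theorem restrictedDeriv_tangentVector_zero (f : PolySystem (k + 1) d) (lam : ℝ)
    (i : Fin (k + 1)) :
    restrictedDeriv f (e1 (k + 1) : E (k + 1)) lam (tangentVector k 0) i =
      if i = 0 then -1 else 0 := by
  refine (fderiv_eigenMap_apply f _ 0 lam 1 i).trans ?_
  rw [e1_coe_apply]
  simp [apply_ite]

theorem restrictedDeriv_tangentVector_succ (hd : 1 ≤ d) (f : PolySystem (k + 1) d) (lam : ℝ)
    (i : Fin (k + 1)) (j : Fin k) :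
    restrictedDeriv f (e1 (k + 1) : E (k + 1)) lam (tangentVector k j.succ) i =
      √d * (f i).bwCoord (linearExponent k d j) - if i = j.succ then lam else 0 := by
  refine (fderiv_eigenMap_apply f _ (EuclideanSpace.single j.succ 1) lam 0 i).trans ?_
  simp only [e1_coe_apply]
  rw [Finset.sum_eq_single j.succ (fun l _ hl => by simp [hl]) (by simp), eval_pderiv_succ hd]
  simp

/-- The direction (0, 1) gives the column -e_1. Laplace expansion along it leaves the block √d G -
λI = √d (G - (λ/√d) I), and row 0 of the remaining columns drops out. -/
theorem absDet_restrictedDeriv (hd : 1 ≤ d) (f : PolySystem (k + 1) d) (lam : ℝ) :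
    absDet (restrictedDeriv f (e1 (k + 1) : E (k + 1)) lam) =
      √d ^ k * |(shiftedMatrix (lam / √d) fun p : Fin k × Fin k =>
        (f p.1.succ).bwCoord (linearExponent k d p.2)).det| := by
  obtain ⟨b, hb⟩ := exists_orthonormalBasis_tangentVector k
  rw [absDet_eq_abs_det_toMatrix b (EuclideanSpace.basisFun _ ℝ)]
  set N := LinearMap.toMatrix b.toBasis (EuclideanSpace.basisFun (Fin (k + 1)) ℝ).toBasis
    (restrictedDeriv f (e1 (k + 1) : E (k + 1)) lam) with hN
  have hNij : ∀ i j, N i j =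
      restrictedDeriv f (e1 (k + 1) : E (k + 1)) lam (tangentVector k j) i := by
    intro i j
    rw [hN, LinearMap.toMatrix_apply, OrthonormalBasis.coe_toBasis, hb]
    simp
  have hs : √(d : ℝ) ≠ 0 := by positivity
  have hsub : N.submatrix Fin.succ Fin.succ = √(d : ℝ) • shiftedMatrix (lam / √d)
      fun p : Fin k × Fin k => (f p.1.succ).bwCoord (linearExponent k d p.2) := by
    ext i j
    rw [Matrix.submatrix_apply, hNij, restrictedDeriv_tangentVector_succ hd, Matrix.smul_apply,
      shiftedMatrix, Matrix.of_apply, smul_eq_mul, mul_sub]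
    simp only [Fin.succ_inj, mul_ite, mul_zero, mul_div_cancel₀ _ hs]
  have hdet : N.det = -(N.submatrix Fin.succ Fin.succ).det := by
    rw [Matrix.det_succ_column_zero, Finset.sum_eq_single 0 (fun i _ hi => ?_) (by simp)]
    · rw [hNij, restrictedDeriv_tangentVector_zero]
      simp
    · rw [hNij, restrictedDeriv_tangentVector_zero]
      simp [hi]
  rw [hdet, hsub, Matrix.det_smul, Fintype.card_fin, abs_neg, abs_mul,
    abs_of_nonneg (by positivity : 0 ≤ √(d : ℝ) ^ k)]

end RestrictedDerivative

/-! ### The fiber integral as a Gaussian matrix expectation -/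

section FiberIntegral

open ProbabilityTheory

variable {k d : ℕ}

/-- Of the k + 1 normalizing factors 1/√(2π) belonging to the fixed coordinates, one completes the
normal density of λ and k remain. -/
theorem stdNormalDensity_fiberParam (lam : ℝ) (y : FreeCoords k d) :
    stdNormalDensity (PolySystem (k + 1) d) (fiberParam lam y) =
      (√(2 * Real.pi) ^ k)⁻¹ * gaussianPDFReal 0 1 lam * stdNormalDensity (FreeCoords k d) y := by
  have h : Real.exp (-(‖y‖ ^ 2 + lam ^ 2) / 2) =
      Real.exp (-lam ^ 2 / 2) * Real.exp (-‖y‖ ^ 2 / 2) := by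
    rw [← Real.exp_add]
    congr 1
    ring
  simp only [stdNormalDensity, norm_sq_fiberParam, finrank_polySystem, gaussianPDFReal, h, sub_zero,
    NNReal.coe_one, mul_one, pow_add, pow_one, mul_inv]
  ring

/-- The matrix of the free coordinates entering the restricted derivative. -/
noncomputable def linearEntries (hd : 1 ≤ d) (y : FreeCoords k d) (p : Fin k × Fin k) : ℝ :=
  y (p.1.succ, ⟨linearExponent k d p.2, linearExponent_mem hd p.2⟩)

theorem map_linearEntries (hd : 1 ≤ d) :
    (stdGaussian (FreeCoords k d)).map (linearEntries hd) = entryLaw (Fin k) := by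
  let e : Fin k × Fin k → Fin (k + 1) × freeExponents k d := fun p =>
    (p.1.succ, ⟨linearExponent k d p.2, linearExponent_mem hd p.2⟩)
  refine map_stdGaussian_entries (e := e) fun p q h => ?_
  simp only [e, Prod.mk.injEq, Fin.succ_inj, Subtype.mk.injEq] at h
  exact Prod.ext h.1 (linearExponent_injective h.2)

theorem fiberIntegrand_fiberParam (hd : 1 ≤ d) (lam : ℝ) (y : FreeCoords k d) :
    fiberIntegrand (e1 (k + 1)) lam (fiberParam lam y) =
      √d ^ k * (√(2 * Real.pi) ^ k)⁻¹ * gaussianPDFReal 0 1 lam *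
        (stdNormalDensity (FreeCoords k d) y *
          |(shiftedMatrix (lam / √d) (linearEntries hd y)).det|) := by
  rw [fiberIntegrand, absDet_restrictedDeriv hd, stdNormalDensity_fiberParam]
  have h : (fun p : Fin k × Fin k =>
      (fiberParam lam y p.1.succ).bwCoord (linearExponent k d p.2)) = linearEntries hd y := by
    ext p
    exact bwCoord_fiberParam_free lam y p.1.succ ⟨_, linearExponent_mem hd p.2⟩
  rw [h]
  ring

theorem continuous_linearEntries (hd : 1 ≤ d) :
    Continuous (linearEntries hd : FreeCoords k d → Fin k × Fin k → ℝ) := by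
  unfold linearEntries
  fun_prop

/-- The determinant depends only on k² distinct free coordinates, whose marginal law is `entryLaw`.
-/
theorem integrable_and_integral_stdNormalDensity_mul (hd : 1 ≤ d) (μ : ℝ) :
    Integrable (fun y : FreeCoords k d => stdNormalDensity (FreeCoords k d) y *
        |(shiftedMatrix μ (linearEntries hd y)).det|) ∧
      ∫ y : FreeCoords k d, stdNormalDensity (FreeCoords k d) y *
          |(shiftedMatrix μ (linearEntries hd y)).det| =
        ∫ g, |(shiftedMatrix μ g).det| ∂entryLaw (Fin k) := by
  have hm := (continuous_linearEntries (k := k) hd).measurable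
  have hc : Continuous fun g : Fin k × Fin k → ℝ => |(shiftedMatrix μ g).det| :=
    (continuous_shiftedMatrix μ).matrix_det.abs
  have hdm : Measurable fun z => ENNReal.ofReal (stdNormalDensity (FreeCoords k d) z) :=
    continuous_stdNormalDensity.measurable.ennreal_ofReal
  have htop : ∀ᵐ z : FreeCoords k d, ENNReal.ofReal (stdNormalDensity (FreeCoords k d) z) < ⊤ :=
    .of_forall fun _ => ENNReal.ofReal_lt_top
  have htr : ∀ z : FreeCoords k d, (ENNReal.ofReal (stdNormalDensity (FreeCoords k d) z)).toReal =
      stdNormalDensity (FreeCoords k d) z :=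
    fun z => ENNReal.toReal_ofReal (stdNormalDensity_nonneg z)
  constructor
  · have h := integrable_abs_det (ι := Fin k) μ
    rw [← map_linearEntries hd, integrable_map_measure hc.aestronglyMeasurable hm.aemeasurable,
      stdGaussian_eq_withDensity, integrable_withDensity_iff_integrable_smul' hdm htop] at h
    simp only [htr] at h
    exact h
  · rw [← map_linearEntries hd, integral_map hm.aemeasurable hc.aestronglyMeasurable,
      stdGaussian_eq_withDensity, integral_withDensity_eq_integral_toReal_smul hdm htop]
    simp only [htr, smul_eq_mul]

end FiberIntegral

end TensorEig

theorem proposition4p3 (n d : ℕ) [NeZero n] (hn : 2 ≤ n) (hd : 1 ≤ d) (lam : ℝ) :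
    Integrable (TensorEig.fiberIntegrand (n := n) (d := d) (TensorEig.e1 n) lam)
        (TensorEig.fiberMeasure (TensorEig.e1 n) lam) ∧
      TensorEig.J d (TensorEig.e1 n) lam =
        √(d : ℝ) ^ (n - 1) * Real.Gamma ((n : ℝ) / 2) / √Real.pi ^ n *
          (Real.exp (lam ^ 2 / (2 * (d : ℝ))) *
              (TensorEig.upperGamma ((n : ℝ) - 1) (lam ^ 2 / (d : ℝ)) / Real.Gamma ((n : ℝ) - 1)) +
            2 ^ (n - 2) * (lam ^ 2 / (2 * (d : ℝ))) ^ (((n : ℝ) - 1) / 2) *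
              (TensorEig.lowerGamma (((n : ℝ) - 1) / 2) (lam ^ 2 / (2 * (d : ℝ))) /
                Real.Gamma ((n : ℝ) - 1))) *
          ProbabilityTheory.gaussianPDFReal 0 1 lam := by
  -- The matrix has size n - 1 = m + 1, hence is nonempty, as the choice of a column i₀ requires.
  obtain ⟨m, rfl⟩ : ∃ m, n = m + 1 + 1 := ⟨n - 2, by omega⟩
  have hI := TensorEig.integrable_and_integral_stdNormalDensity_mul (k := m + 1) hd (lam / √d)
  have hemb := TensorEig.measurableEmbedding_fiberParam (k := m + 1) (d := d) lam
  have hmeas := TensorEig.fiberMeasure_eq_map (k := m + 1) (d := d) lam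
  have hfun := fun y => TensorEig.fiberIntegrand_fiberParam (k := m + 1) hd lam y
  constructor
  · refine hmeas ▸ (hemb.integrable_map_iff.2 ?_)
    exact (hI.1.const_mul _).congr (.of_forall fun y => (hfun y).symm)
  · have hJ : TensorEig.J d (TensorEig.e1 (m + 1 + 1)) lam = _ :=
      (congrArg (fun ν => ∫ f, TensorEig.fiberIntegrand (TensorEig.e1 (m + 1 + 1)) lam f ∂ν)
        hmeas).trans (hemb.integral_map _)
    refine hJ.trans ?_
    simp_rw [hfun]
    rw [integral_const_mul, hI.2]
    have hdet := TensorEig.integral_abs_det_shiftedMatrix m (lam / √d)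
    have hsq : (lam / √(d : ℝ)) ^ 2 = lam ^ 2 / d := by
      rw [div_pow, Real.sq_sqrt (Nat.cast_nonneg d)]
    have hsq2 : lam ^ 2 / (d : ℝ) / 2 = lam ^ 2 / (2 * d) := by
      rw [div_div, mul_comm]
    have hn1 : ((m + 1 + 1 : ℕ) : ℝ) = m + 2 := by
      push_cast
      ring
    have hn2 : (m + 2 : ℝ) - 1 = m + 1 := by ring
    rw [hsq, hsq2] at hdet
    rw [hn1, hn2]
    rw [show m + 1 + 1 - 2 = m from rfl, show m + 1 + 1 - 1 = m + 1 from rfl]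
    linear_combination √(d : ℝ) ^ (m + 1) * ProbabilityTheory.gaussianPDFReal 0 1 lam * hdet
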